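/- Let $(X,\mu)$ and $(Y,\nu)$ be non-atomic Lebesgue (standard Borel) probability spaces, and let $\{R^z\}_{z\in\mathbb Z^2}$ and $\{T^z\}_{z\in\mathbb Z^2}$ be measure-preserving $\mathbb Z^2$-actions on $(X,\mu)$ and $(Y,\nu)$. Write $\hat S^z f = f\circ S^z$ for the operators induced by an action on the complex space $L_2$, $I$ for the identity operator, $\Theta$ for the orthogonal projection of $L_2$ onto the constants, and $L_2^0$ for the orthogonal complement of the constants. The symmetric square $\hat S^z\odot\hat S^z$ is the restriction of $\hat S^z\otimes\hat S^z$ to the space of symmetric functions $g(x,y)=g(y,x)$ in $L_2$ of the Cartesian square; it has *simple spectrum* if the space of symmetric functions orthogonal to the constants is the closed linear span of the orbit $\{(\hat S^z\otimes\hat S^z)h\}_{z\in\mathbb Z^2}$ of a single vector $h$. Suppose that the product action $\{R^z\times R^z\times T^z\times T^z\}_{z\in\mathbb Z^2}$ on $(X\times X\times Y\times Y,\ \mu\times\mu\times\nu\times\nu)$ is totally ergodic, i.e. each of its elements with $z\neq 0$ is ergodic. Suppose further that 1. the symmetric squares $\{\hat R^z\odot\hat R^z\}_{z\in\mathbb Z^2}$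 and $\{\hat T^z\odot\hat T^z\}_{z\in\mathbb Z^2}$ have simple spectrum; 2. for some sequences $w_i,u_i\in\mathbb Z^2$ and some numbers $a_1,a_2,b_1,b_2>0$ one has, in the weak operator topology as $i\to\infty$, $$\hat R^{w_i}\to a_1 I+(1-a_1)\Theta,\qquad \hat T^{w_i}\to b_1\hat T^{(1,0)}+(1-b_1)\Theta,$$ $$\hat R^{u_i}\to a_2 I+(1-a_2)\Theta,\qquad \hat T^{u_i}\to b_2\hat T^{(0,1)}+(1-b_2)\Theta.$$ Then the action $\{R^z\times R^z\times T^z\times T^z\}_{z\in\mathbb Z^2}$ has set of spectral multiplicities $\{2,4\}$ on $L_2^0$: the space $L_2^0(X\times X\times Y\times Y)$ is the orthogonal sum of two nonzero closed invariant subspaces $P_2$ and $P_4$ such that there is no nonzero bounded operator between $P_2$ and $P_4$ (in either direction) intertwining the restrictions of the action, and, for $n\in\{2,4\}$, $P_n$ is the orthogonal sum of $n$ cyclic subspaces (closed linear spans of orbits of single vectors) on which the restrictions of the action are pairwise unitarily isomorphic. -/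

import Mathlib

open MeasureTheory Filter Topology

noncomputable section

/-! ### Unitary families indexed by `ℤ × ℤ`: cyclic subspaces, homogeneous spectrum, multiplicities -/

section Spectral

variable {H : Type*} [NormedAddCommGroup H] [InnerProductSpace ℂ H]

/-- The closed linear span of the orbit `U z h`, `z ∈ ℤ²`. -/
def cyclicSpan (U : ℤ × ℤ → H →L[ℂ] H) (h : H) : Submodule ℂ H :=
  (Submodule.span ℂ (Set.range fun z => U z h)).topologicalClosure

/-- `C` is a cyclic subspace: the closed linear span of the orbit of some vector. -/
def IsCyclicSubspace (U : ℤ × ℤ → H →L[ℂ] H) (C : Submodule ℂ H) : Prop :=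
  ∃ h : H, cyclicSpan U h = C

/-- A bounded operator `J : K → L` between invariant subspaces intertwines the restrictions of `U`:
`J (U z x) = U z (J x)` for `x ∈ K`. -/
def Intertwines (U : ℤ × ℤ → H →L[ℂ] H) {K L : Submodule ℂ H} (J : K →L[ℂ] L) : Prop :=
  ∀ (z : ℤ × ℤ) (x y : K), (y : H) = U z (x : H) → (J y : H) = U z (J x : H)

/-- The restrictions of `U` to the invariant subspaces `K` and `L` are unitarily isomorphic. -/
def RestrictionsIsomorphic (U : ℤ × ℤ → H →L[ℂ] H) (K L : Submodule ℂ H) : Prop :=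
  ∃ Φ : K ≃ₗᵢ[ℂ] L, Intertwines U (Φ.toContinuousLinearEquiv : K →L[ℂ] L)

/-- The restrictions of `U` to the invariant subspaces `K` and `L` are (spectrally) disjoint:
there is no nonzero intertwining operator. -/
def RestrictionsDisjoint (U : ℤ × ℤ → H →L[ℂ] H) (K L : Submodule ℂ H) : Prop :=
  ∀ J : K →L[ℂ] L, Intertwines U J → J = 0

/-- The restriction of `U` to `K` has homogeneous spectrum of multiplicity `n ∈ {1, 2, …, ∞}`:
`K` is the orthogonal Hilbert sum of `n` cyclic subspaces on which the restrictions of `U` are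
isomorphic to each other. -/
def HasHomogeneousSpectrum (U : ℤ × ℤ → H →L[ℂ] H) (K : Submodule ℂ H) (n : ℕ∞) : Prop :=
  1 ≤ n ∧
  ∃ C : {i : ℕ // (i : ℕ∞) < n} → Submodule ℂ H,
    (∀ i, IsCyclicSubspace U (C i)) ∧
    (Pairwise fun i j => C i ⟂ C j) ∧
    (⨆ i, C i).topologicalClosure = K ∧
    ∀ i j, RestrictionsIsomorphic U (C i) (C j)

/-- The restriction of `U` to `K` has set of spectral multiplicities `M ⊆ {1, 2, …, ∞}`:
`K` is the orthogonal Hilbert sum of nonzero, pairwise disjoint parts `P n`, `n ∈ M`, where `P n`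
has homogeneous spectrum of multiplicity `n`.  Equivalently, `M` is the set of essential values of
the spectral multiplicity function. -/
def HasMultiplicitySet (U : ℤ × ℤ → H →L[ℂ] H) (K : Submodule ℂ H) (M : Set ℕ∞) : Prop :=
  ∃ P : M → Submodule ℂ H,
    (∀ n, P n ≠ ⊥) ∧
    (∀ n, HasHomogeneousSpectrum U (P n) n) ∧
    (Pairwise fun m n => P m ⟂ P n) ∧
    (Pairwise fun m n => RestrictionsDisjoint U (P m) (P n)) ∧
    (⨆ n, P n).topologicalClosure = K

/-- Convergence of a sequence of operators in the weak operator topology. -/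
def WeakOperatorTendsto (A : ℕ → H →L[ℂ] H) (B : H →L[ℂ] H) : Prop :=
  ∀ f g : H, Tendsto (fun i => inner ℂ (A i f) g) atTop (𝓝 (inner ℂ (B f) g))

end Spectral

/-! ### Constants in `L²` -/

section Constants

variable {X : Type*} [MeasurableSpace X] (μ : Measure X) [IsProbabilityMeasure μ]

/-- The subspace of constants in `L²(X, μ)`. -/
def constSubspace : Submodule ℂ (Lp ℂ 2 μ) :=
  Submodule.span ℂ {Lp.const 2 μ (1 : ℂ)}

instance : FiniteDimensional ℂ (constSubspace μ) := by
  unfold constSubspace; infer_instance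

/-- The orthogonal projection `Θ` onto the constants. -/
def constProj : Lp ℂ 2 μ →L[ℂ] Lp ℂ 2 μ :=
  (constSubspace μ).starProjection

/-- `L²₀(X, μ)`, the orthogonal complement of the constants. -/
def L2Zero : Submodule ℂ (Lp ℂ 2 μ) :=
  (constSubspace μ)ᗮ

/-- The subspace of functions `g ∈ L²(X × X, μ × μ)` with `g(x, y) = g(y, x)`,
that is, the symmetric tensor square of `L²(X, μ)`. -/
def symmSubspace : Submodule ℂ (Lp ℂ 2 (μ.prod μ)) :=
  LinearMap.eqLocus
    (Lp.compMeasurePreservingₗᵢ ℂ (Prod.swap : X × X → X × X)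
      (Measure.measurePreserving_swap (μ := μ) (ν := μ))).toLinearMap
    LinearMap.id

end Constants

/-! ### Measure-preserving `ℤ²`-actions -/

/-- A measure-preserving `ℤ²`-action on `(X, μ)`; as usual for automorphisms of a measure space,
the group law is understood modulo null sets. -/
structure Z2Action {X : Type*} [MeasurableSpace X] (μ : Measure X) where
  /-- the transformation `S^z` -/
  map : ℤ × ℤ → X → X
  measurePreserving : ∀ z, MeasurePreserving (map z) μ μ
  map_zero : map 0 =ᵐ[μ] id
  map_add : ∀ z₁ z₂, map z₁ ∘ map z₂ =ᵐ[μ] map (z₁ + z₂)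

namespace Z2Action

variable {X Y : Type*} [MeasurableSpace X] [MeasurableSpace Y] {μ : Measure X} {ν : Measure Y}

/-- The operators `(Ŝ^z f)(x) = f(S^z x)` on `L²(X, μ)`. -/
def koopman (S : Z2Action μ) (z : ℤ × ℤ) : Lp ℂ 2 μ →L[ℂ] Lp ℂ 2 μ :=
  (Lp.compMeasurePreservingₗᵢ ℂ (S.map z) (S.measurePreserving z)).toContinuousLinearMap

/-- The diagonal product action `S^z × T^z` on `(X × Y, μ × ν)`; its operators are
`Ŝ^z ⊗ T̂^z` on `L²(X × Y, μ × ν) = L²(X, μ) ⊗ L²(Y, ν)`. -/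
def prod [SFinite μ] [SFinite ν] (S : Z2Action μ) (T : Z2Action ν) : Z2Action (μ.prod ν) where
  map z := Prod.map (S.map z) (T.map z)
  measurePreserving z := (S.measurePreserving z).prod (T.measurePreserving z)
  map_zero := by
    filter_upwards [Measure.quasiMeasurePreserving_fst.ae S.map_zero,
      Measure.quasiMeasurePreserving_snd.ae T.map_zero] with p h₁ h₂
    exact Prod.ext h₁ h₂
  map_add z₁ z₂ := by
    filter_upwards [Measure.quasiMeasurePreserving_fst.ae (S.map_add z₁ z₂),
      Measure.quasiMeasurePreserving_snd.ae (T.map_add z₁ z₂)] with p h₁ h₂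
    exact Prod.ext h₁ h₂

/-- Total ergodicity: every transformation `S^z` with `z ≠ 0` is ergodic. -/
def TotallyErgodic (S : Z2Action μ) : Prop :=
  ∀ z : ℤ × ℤ, z ≠ 0 → Ergodic (S.map z) μ

/-- The symmetric square `Ŝ^z ⊙ Ŝ^z`, i.e. the restriction of `Ŝ^z ⊗ Ŝ^z` to the symmetric
functions in `L²(X × X)`, has simple spectrum: the orthogonal complement of the constants
in the space of symmetric functions is a cyclic subspace. -/
def SymmSquareHasSimpleSpectrum [IsProbabilityMeasure μ] (S : Z2Action μ) : Prop :=
  IsCyclicSubspace (S.prod S).koopman (symmSubspace μ ⊓ L2Zero (μ.prod μ))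

/-- `M` is the set of spectral multiplicities of the action on `L²₀(X, μ)`. -/
def HasSpectralMultiplicities [IsProbabilityMeasure μ] (S : Z2Action μ) (M : Set ℕ∞) : Prop :=
  HasMultiplicitySet S.koopman (L2Zero μ) M

end Z2Action

end

/-!
Put `V = 1 ⊗ T̂^e ⊗ T̂^e` for a standard generator `e`. The given weak limits multiply up to weak
limits `V N` of the product action with `N` positive and invertible, so an operator commuting with
the product action commutes with the polar part `V`, hence with every `1 ⊗ T̂^z ⊗ T̂^z`.

On the square of a weakly mixing action, `Ŝ^e ⊗ 1 - 1 ⊗ Ŝ^e` exchanges symmetric and antisymmetric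
functions and is injective modulo the constants, so its polar part makes both halves unitarily
equivalent: simple spectrum of the symmetric square gives two generators `a₁, a₂` of the square of
`R`, and likewise `b₁, b₂` for `T`. In the product, `a₁ ⊗ 1 + 1 ⊗ b₁` and `a₂ ⊗ 1 + 1 ⊗ b₂`
generate the part of multiplicity 2, since the splitting of the commutant separates the two
summands, and the four vectors `aᵢ ⊗ bⱼ` generate the rest. The two parts are disjoint because an
intertwiner sends `f ⊗ 1` to a vector fixed by every `1 ⊗ T̂^z ⊗ T̂^z`.
-/

noncomputable section

/-! ### Unitary representations -/

section UnitaryRepresentations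

variable {H : Type*} [NormedAddCommGroup H] [InnerProductSpace ℂ H] {U : ℤ × ℤ → H →L[ℂ] H}

/-- `U` is a unitary representation of `ℤ²`; surjectivity of the `U z` follows from the group
law. -/
structure IsUnitaryRep (U : ℤ × ℤ → H →L[ℂ] H) : Prop where
  map_zero : U 0 = 1
  map_add : ∀ z z', U (z + z') = U z * U z'
  inner_map_map : ∀ z x y, inner ℂ (U z x) (U z y) = inner ℂ x y

theorem apply_mem_cyclicSpan (z : ℤ × ℤ) (h : H) : U z h ∈ cyclicSpan U h :=
  Submodule.le_topologicalClosure _ (Submodule.subset_span ⟨z, rfl⟩)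

theorem isClosed_cyclicSpan (h : H) : IsClosed (cyclicSpan U h : Set H) :=
  Submodule.isClosed_topologicalClosure _

theorem cyclicSpan_le {h : H} {K : Submodule ℂ H} (hK : IsClosed (K : Set H))
    (hh : ∀ z, U z h ∈ K) : cyclicSpan U h ≤ K :=
  Submodule.topologicalClosure_minimal _
    (Submodule.span_le.2 (Set.range_subset_iff.2 hh)) hK

theorem cyclicSpan_isOrtho {h h' : H} (hh : ∀ z z', inner ℂ (U z h) (U z' h') = 0) :
    cyclicSpan U h ⟂ cyclicSpan U h' := by
  refine cyclicSpan_le (Submodule.isClosed_orthogonal _) fun z => ?_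
  have orbit_le : cyclicSpan U h' ≤ (Submodule.span ℂ {U z h})ᗮ :=
    cyclicSpan_le (Submodule.isClosed_orthogonal _) fun z' =>
      Submodule.mem_orthogonal_singleton_iff_inner_right.2 (hh z z')
  exact (Submodule.mem_orthogonal' _ _).2 fun y hy =>
    Submodule.mem_orthogonal_singleton_iff_inner_right.1 (orbit_le hy)

theorem map_mem_of_commute_starProjection {K : Submodule ℂ H} [K.HasOrthogonalProjection]
    {A : H →L[ℂ] H} (hA : Commute K.starProjection A) {x : H} (hx : x ∈ K) : A x ∈ K := by
  have apply_comm : K.starProjection (A x) = A (K.starProjection x) := DFunLike.congr_fun hA.eq x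
  rw [Submodule.starProjection_eq_self_iff.2 hx] at apply_comm
  exact Submodule.starProjection_eq_self_iff.1 apply_comm

namespace IsUnitaryRep

theorem map_neg_apply (hU : IsUnitaryRep U) (z : ℤ × ℤ) (x : H) : U (-z) (U z x) = x := by
  rw [← mul_apply_eq_comp, ← hU.map_add, neg_add_cancel, hU.map_zero, one_apply_eq_self]

theorem map_apply_neg (hU : IsUnitaryRep U) (z : ℤ × ℤ) (x : H) : U z (U (-z) x) = x := by
  simpa using hU.map_neg_apply (-z) x

theorem inner_map_left (hU : IsUnitaryRep U) (z : ℤ × ℤ) (x y : H) :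
    inner ℂ (U z x) y = inner ℂ x (U (-z) y) := by
  rw [← hU.inner_map_map z x, hU.map_apply_neg]

theorem inner_orbit (hU : IsUnitaryRep U) (z z' : ℤ × ℤ) (x y : H) :
    inner ℂ (U z x) (U z' y) = inner ℂ (U (-z' + z) x) y := by
  rw [hU.map_add, mul_apply_eq_comp, hU.inner_map_left (-z'), neg_neg]

theorem commute (hU : IsUnitaryRep U) (z z' : ℤ × ℤ) : Commute (U z) (U z') := by
  rw [Commute, SemiconjBy, ← hU.map_add, ← hU.map_add, add_comm]

theorem self_mem_cyclicSpan (hU : IsUnitaryRep U) (h : H) : h ∈ cyclicSpan U h := by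
  simpa [hU.map_zero] using apply_mem_cyclicSpan (U := U) 0 h

theorem map_mem_cyclicSpan (hU : IsUnitaryRep U) {h x : H} (z : ℤ × ℤ) (hx : x ∈ cyclicSpan U h) :
    U z x ∈ cyclicSpan U h := by
  have le_comap : cyclicSpan U h ≤ (cyclicSpan U h).comap (U z).toLinearMap :=
    cyclicSpan_le ((isClosed_cyclicSpan h).preimage (U z).continuous) fun z' => by
      rw [Submodule.mem_comap, ContinuousLinearMap.coe_coe, ← mul_apply_eq_comp, ← hU.map_add]
      exact apply_mem_cyclicSpan _ h
  exact le_comap hx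

theorem commute_starProjection (hU : IsUnitaryRep U) {K : Submodule ℂ H}
    [K.HasOrthogonalProjection] (hK : ∀ z, ∀ x ∈ K, U z x ∈ K) (z : ℤ × ℤ) :
    Commute K.starProjection (U z) := by
  ext x
  refine Submodule.eq_starProjection_of_mem_of_inner_eq_zero
    (hK z _ (K.starProjection_apply_mem x)) fun y hy => ?_
  rw [mul_apply_eq_comp, ContinuousLinearMap.coe_coe, ← map_sub, hU.inner_map_left]
  exact K.starProjection_inner_eq_zero _ _ (hK _ _ hy)

theorem commute_of_commute_basis (hU : IsUnitaryRep U) {J : H →L[ℂ] H}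
    (h₁ : Commute J (U (1, 0))) (h₂ : Commute J (U (0, 1))) (z : ℤ × ℤ) : Commute J (U z) := by
  let centralized : AddSubgroup (ℤ × ℤ) :=
    { carrier := {z | Commute J (U z)}
      zero_mem' := by simp only [Set.mem_ofPred_eq, hU.map_zero, Commute.one_right]
      add_mem' := fun {z z'} hz hz' => by
        simpa only [Set.mem_ofPred_eq, hU.map_add] using Commute.mul_right hz hz'
      neg_mem' := fun {z} hz => by
        have mul_neg : U z * U (-z) = 1 := by rw [← hU.map_add, add_neg_cancel, hU.map_zero]
        have neg_mul : U (-z) * U z = 1 := by rw [← hU.map_add, neg_add_cancel, hU.map_zero]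
        exact Commute.units_inv_right (u := ⟨U z, U (-z), mul_neg, neg_mul⟩) hz }
  have z_eq : z = z.1 • ((1, 0) : ℤ × ℤ) + z.2 • ((0, 1) : ℤ × ℤ) := by ext <;> simp
  have z_mem : z ∈ centralized :=
    z_eq ▸ centralized.add_mem (centralized.zsmul_mem h₁ _) (centralized.zsmul_mem h₂ _)
  exact z_mem

theorem star_eq [CompleteSpace H] (hU : IsUnitaryRep U) (z : ℤ × ℤ) : star (U z) = U (-z) := by
  rw [ContinuousLinearMap.star_eq_adjoint]
  refine ((ContinuousLinearMap.eq_adjoint_iff _ _).2 fun x y => ?_).symm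
  rw [hU.inner_map_left, neg_neg]

theorem star_mul_self [CompleteSpace H] (hU : IsUnitaryRep U) (z : ℤ × ℤ) :
    star (U z) * U z = 1 := by
  rw [hU.star_eq, ← hU.map_add, neg_add_cancel, hU.map_zero]

theorem commute_star [CompleteSpace H] (hU : IsUnitaryRep U) {J : H →L[ℂ] H}
    (hJ : ∀ z, Commute J (U z)) (z : ℤ × ℤ) : Commute (star J) (U z) := by
  simpa only [hU.star_eq, neg_neg] using (hJ (-z)).star_star

end IsUnitaryRep

/-! ### Unitary isomorphism of restrictions -/

section ClosureRange

variable {V : Type*} [AddCommGroup V] [Module ℂ V]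

/-- A linear map with values in a Hilbert space, regarded as a map into the closure of its range,
on which isometries defined on the range extend. -/
def toClosureRange (A : V →ₗ[ℂ] H) : V →ₗ[ℂ] A.range.topologicalClosure :=
  Submodule.inclusion A.range.le_topologicalClosure ∘ₗ A.rangeRestrict

theorem denseRange_toClosureRange (A : V →ₗ[ℂ] H) : DenseRange (toClosureRange A) := by
  have dense_inclusion : DenseRange (Set.inclusion A.range.le_topologicalClosure) :=
    (denseRange_inclusion_iff _).2 subset_rfl
  exact dense_inclusion.comp A.surjective_rangeRestrict.denseRange (continuous_inclusion _)

theorem restrictionsIsomorphic_closure_range [CompleteSpace H] {A B : V →ₗ[ℂ] H}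
    (hAB : ∀ v, ‖A v‖ = ‖B v‖) (σ : ℤ × ℤ → V → V) (hA : ∀ z v, A (σ z v) = U z (A v))
    (hB : ∀ z v, B (σ z v) = U z (B v)) :
    RestrictionsIsomorphic U A.range.topologicalClosure B.range.topologicalClosure := by
  let Φ := (LinearEquiv.refl ℂ V).extendOfIsometry _ _
    (denseRange_toClosureRange A) (denseRange_toClosureRange B) fun v => (hAB v).symm
  have hΦ : ∀ v, Φ (toClosureRange A v) = toClosureRange B v :=
    (LinearEquiv.refl ℂ V).extendOfIsometry_eq _ _ _ _ _
  have U_mem : ∀ z (x : A.range.topologicalClosure), U z x ∈ A.range.topologicalClosure := by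
    intro z x
    refine map_mem_closure (U z).continuous x.2 ?_
    rintro _ ⟨v, rfl⟩
    exact ⟨σ z v, hA z v⟩
  refine ⟨Φ, fun z x y hxy => ?_⟩
  obtain rfl : y = ⟨U z x, U_mem z x⟩ := Subtype.ext hxy
  refine (denseRange_toClosureRange A).induction_on x (isClosed_eq ?_ ?_) fun v => ?_
  · exact continuous_subtype_val.comp (Φ.continuous.comp
      (((U z).continuous.comp continuous_subtype_val).subtype_mk _))
  · exact (U z).continuous.comp (continuous_subtype_val.comp Φ.continuous)
  · have map_orbit : (⟨U z (toClosureRange A v), U_mem z _⟩ : A.range.topologicalClosure) =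
        toClosureRange A (σ z v) := Subtype.ext (hA z v).symm
    change (Φ _ : H) = U z (Φ _)
    rw [map_orbit, hΦ, hΦ]
    exact hB z v

end ClosureRange

theorem cyclicSpan_eq_closure_range (h : H) :
    cyclicSpan U h =
      (Finsupp.linearCombination ℂ fun z => U z h).range.topologicalClosure := by
  rw [cyclicSpan, Finsupp.range_linearCombination]

theorem IsUnitaryRep.restrictionsIsomorphic_cyclicSpan [CompleteSpace H] (hU : IsUnitaryRep U)
    {h h' : H} (hh : ∀ z, inner ℂ (U z h) h = inner ℂ (U z h') h') :
    RestrictionsIsomorphic U (cyclicSpan U h) (cyclicSpan U h') := by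
  have orbit_shift : ∀ (k : H) (z : ℤ × ℤ) (c : ℤ × ℤ →₀ ℂ),
      Finsupp.linearCombination ℂ (fun z => U z k) (c.mapDomain (z + ·)) =
        U z (Finsupp.linearCombination ℂ (fun z => U z k) c) := by
    intro k z c
    rw [Finsupp.linearCombination_mapDomain, ← ContinuousLinearMap.coe_coe (U z),
      Finsupp.apply_linearCombination]
    congr 2
    funext z'
    simp [hU.map_add]
  rw [cyclicSpan_eq_closure_range, cyclicSpan_eq_closure_range]
  refine restrictionsIsomorphic_closure_range (fun c => ?_) (fun z c => c.mapDomain (z + ·))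
    (orbit_shift h) (orbit_shift h')
  rw [← sq_eq_sq₀ (norm_nonneg _) (norm_nonneg _), ← Complex.ofReal_inj]
  push_cast
  simp only [← Complex.coe_algebraMap, ← inner_self_eq_norm_sq_to_K (𝕜 := ℂ),
    Finsupp.linearCombination_apply, Finsupp.sum, sum_inner, inner_sum, inner_smul_left,
    inner_smul_right, hU.inner_orbit, hh]

theorem norm_cfcAbs_apply [CompleteSpace H] (A : H →L[ℂ] H) (x : H) : ‖CFC.abs A x‖ = ‖A x‖ := by
  have abs_selfAdjoint : star (CFC.abs A) = CFC.abs A := (CFC.abs_nonneg A).isSelfAdjoint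
  have sq_eq : star (CFC.abs A) * CFC.abs A = star A * A := by
    rw [abs_selfAdjoint, CFC.abs_mul_abs]
  have inner_eq := congrArg (fun B : H →L[ℂ] H => inner ℂ x (B x)) sq_eq
  simp only [mul_apply_eq_comp, ContinuousLinearMap.star_eq_adjoint,
    ContinuousLinearMap.adjoint_inner_right, inner_self_eq_norm_sq_to_K (𝕜 := ℂ)] at inner_eq
  exact (sq_eq_sq₀ (norm_nonneg _) (norm_nonneg _)).1 (by exact_mod_cast inner_eq)

/-- The isomorphism is the partial isometry in the polar decomposition of `A`. -/
theorem IsUnitaryRep.restrictionsIsomorphic_orthogonal_ker [CompleteSpace H]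
    (hU : IsUnitaryRep U) {A : H →L[ℂ] H} (hA : ∀ z, Commute A (U z)) :
    RestrictionsIsomorphic U A.kerᗮ (star A).kerᗮ := by
  have abs_commute : ∀ z, Commute (CFC.abs A) (U z) := fun z =>
    (hA z).cfcAbs_left (by rw [hU.star_eq]; exact hA _)
  have ker_abs : (CFC.abs A).ker = A.ker := by
    ext x
    simp only [LinearMap.mem_ker, ContinuousLinearMap.coe_coe]
    rw [← norm_eq_zero, norm_cfcAbs_apply, norm_eq_zero]
  rw [← ker_abs, ContinuousLinearMap.orthogonal_ker, ContinuousLinearMap.orthogonal_ker,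
    ContinuousLinearMap.star_eq_adjoint, ContinuousLinearMap.adjoint_adjoint,
    (CFC.abs_nonneg A).isSelfAdjoint.adjoint_eq]
  exact restrictionsIsomorphic_closure_range (norm_cfcAbs_apply A) (fun z => U z)
    (fun z => DFunLike.congr_fun (abs_commute z).eq) fun z => DFunLike.congr_fun (hA z).eq

theorem IsUnitaryRep.exists_generator_of_restrictionsIsomorphic (hU : IsUnitaryRep U)
    {h : H} [CompleteSpace H] {L : Submodule ℂ H}
    (hL : RestrictionsIsomorphic U (cyclicSpan U h) L) :
    ∃ h', cyclicSpan U h' = L ∧ ∀ z, inner ℂ (U z h') h' = inner ℂ (U z h) h := by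
  obtain ⟨Φ, hΦ⟩ := hL
  have complete_cyclicSpan : CompleteSpace (cyclicSpan U h) :=
    (isClosed_cyclicSpan h).completeSpace_coe
  let h₀ : cyclicSpan U h := ⟨h, hU.self_mem_cyclicSpan h⟩
  have map_orbit : ∀ z, (Φ ⟨U z h, apply_mem_cyclicSpan z h⟩ : H) = U z (Φ h₀) := fun z =>
    hΦ z h₀ _ rfl
  have isClosed_L : IsClosed (L : Set H) :=
    (completeSpace_coe_iff_isComplete.1 Φ.symm.toIsometryEquiv.completeSpace).isClosed
  refine ⟨Φ h₀, le_antisymm (cyclicSpan_le isClosed_L fun z => ?_) fun y hy => ?_, fun z => ?_⟩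
  · exact map_orbit z ▸ Subtype.coe_prop _
  · let M : Submodule ℂ (cyclicSpan U h) := (cyclicSpan U (Φ h₀ : H)).comap
      (L.subtype ∘ₗ Φ.toLinearEquiv.toLinearMap)
    have isClosed_M : IsClosed (M : Set (cyclicSpan U h)) :=
      (isClosed_cyclicSpan _).preimage (continuous_subtype_val.comp Φ.continuous)
    have orbit_mem : ∀ z, (⟨U z h, apply_mem_cyclicSpan z h⟩ : cyclicSpan U h) ∈ M := fun z =>
      (congrArg (· ∈ cyclicSpan U (Φ h₀ : H)) (map_orbit z)).mpr (apply_mem_cyclicSpan z _)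
    have cyclicSpan_le_M : cyclicSpan U h ≤ M.map (cyclicSpan U h).subtype :=
      cyclicSpan_le ((isClosed_cyclicSpan h).isClosedEmbedding_subtypeVal.isClosedMap _ isClosed_M)
        fun z => ⟨⟨U z h, apply_mem_cyclicSpan z h⟩, orbit_mem z, rfl⟩
    obtain ⟨x, hx, hxy⟩ := cyclicSpan_le_M (Φ.symm ⟨y, hy⟩).2
    obtain rfl : x = Φ.symm ⟨y, hy⟩ := Subtype.ext hxy
    have Φx_mem : (Φ (Φ.symm ⟨y, hy⟩) : H) ∈ cyclicSpan U (Φ h₀ : H) := hx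
    rwa [Φ.apply_symm_apply] at Φx_mem
  · rw [← map_orbit, ← Submodule.coe_inner, Φ.inner_map_map]
    rfl

end UnitaryRepresentations

/-! ### Families generating homogeneous components -/

section Families

variable {H : Type*} [NormedAddCommGroup H] [InnerProductSpace ℂ H] {U : ℤ × ℤ → H →L[ℂ] H}

/-- The vectors `a i` generate pairwise orthogonal cyclic subspaces and share the correlation
function `φ`: a family of generators of the cyclic summands of a homogeneous component. -/
structure HasDiagonalCorrelation {ι : Type*} (U : ℤ × ℤ → H →L[ℂ] H) (φ : ℤ × ℤ → ℂ)
    (a : ι → H) : Prop where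
  inner_self : ∀ z i, inner ℂ (U z (a i)) (a i) = φ z
  inner_of_ne : ∀ z, Pairwise fun i j => inner ℂ (U z (a i)) (a j) = 0

/-- The closed sum of the cyclic subspaces generated by the vectors `a i`. -/
def cyclicSum {ι : Type*} (U : ℤ × ℤ → H →L[ℂ] H) (a : ι → H) : Submodule ℂ H :=
  (⨆ i, cyclicSpan U (a i)).topologicalClosure

section CyclicSum

variable {ι : Type*} {a : ι → H}

theorem isClosed_cyclicSum : IsClosed (cyclicSum U a : Set H) :=
  Submodule.isClosed_topologicalClosure _

theorem cyclicSpan_le_cyclicSum (i : ι) : cyclicSpan U (a i) ≤ cyclicSum U a :=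
  (le_iSup (fun i => cyclicSpan U (a i)) i).trans (Submodule.le_topologicalClosure _)

theorem cyclicSum_le {K : Submodule ℂ H} (hK : IsClosed (K : Set H))
    (ha : ∀ i z, U z (a i) ∈ K) : cyclicSum U a ≤ K :=
  Submodule.topologicalClosure_minimal _ (iSup_le fun i => cyclicSpan_le hK (ha i)) hK

theorem IsUnitaryRep.mem_cyclicSum (hU : IsUnitaryRep U) (i : ι) : a i ∈ cyclicSum U a :=
  cyclicSpan_le_cyclicSum i (hU.self_mem_cyclicSpan _)

theorem IsUnitaryRep.map_mem_cyclicSum (hU : IsUnitaryRep U) (z : ℤ × ℤ) {x : H}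
    (hx : x ∈ cyclicSum U a) : U z x ∈ cyclicSum U a := by
  have le_comap : cyclicSum U a ≤ (cyclicSum U a).comap (U z).toLinearMap :=
    cyclicSum_le (isClosed_cyclicSum.preimage (U z).continuous) fun i z' =>
      cyclicSpan_le_cyclicSum i (hU.map_mem_cyclicSpan z (apply_mem_cyclicSpan z' _))
  exact le_comap hx

theorem inner_map_eq_zero_of_mem_cyclicSum {κ : Type*} {b : κ → H} {J : H →L[ℂ] H}
    (hJ : ∀ i j z z', inner ℂ (J (U z (a i))) (U z' (b j)) = 0) {x y : H}
    (hx : x ∈ cyclicSum U a) (hy : y ∈ cyclicSum U b) : inner ℂ (J x) y = 0 := by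
  have le_comap : cyclicSum U a ≤ (cyclicSum U b)ᗮ.comap J.toLinearMap := by
    refine cyclicSum_le ((Submodule.isClosed_orthogonal _).preimage J.continuous) fun i z => ?_
    have orbit_le : cyclicSum U b ≤ (Submodule.span ℂ {J (U z (a i))})ᗮ :=
      cyclicSum_le (Submodule.isClosed_orthogonal _) fun j z' =>
        Submodule.mem_orthogonal_singleton_iff_inner_right.2 (hJ i j z z')
    exact (Submodule.mem_orthogonal' _ _).2 fun y hy =>
      Submodule.mem_orthogonal_singleton_iff_inner_right.1 (orbit_le hy)
  exact Submodule.inner_left_of_mem_orthogonal hy (le_comap hx)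

end CyclicSum

/-- The index type of the `n` summands in `HasHomogeneousSpectrum` for finite `n`. -/
def finEquivCastLT (n : ℕ) : Fin n ≃ {i : ℕ // (i : ℕ∞) < n} :=
  Fin.equivSubtype.trans (Equiv.subtypeEquivRight fun _ => Nat.cast_lt.symm)

theorem IsUnitaryRep.hasHomogeneousSpectrum_cyclicSum [CompleteSpace H] (hU : IsUnitaryRep U)
    {ι : Type*} [Fintype ι] [Nonempty ι] {φ : ℤ × ℤ → ℂ} {a : ι → H}
    (ha : HasDiagonalCorrelation U φ a) :
    HasHomogeneousSpectrum U (cyclicSum U a) (Fintype.card ι) := by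
  let e := (finEquivCastLT (Fintype.card ι)).symm.trans (Fintype.equivFin ι).symm
  refine ⟨by exact_mod_cast Fintype.card_pos, fun k => cyclicSpan U (a (e k)), fun k => ⟨_, rfl⟩,
    fun k l hkl => cyclicSpan_isOrtho fun z z' => ?_, ?_, fun k l => ?_⟩
  · rw [hU.inner_orbit]
    exact ha.inner_of_ne _ (e.injective.ne hkl)
  · rw [cyclicSum, e.iSup_comp (g := fun i => cyclicSpan U (a i))]
  · exact hU.restrictionsIsomorphic_cyclicSpan fun z => by rw [ha.inner_self, ha.inner_self]

theorem IsUnitaryRep.exists_hasDiagonalCorrelation [CompleteSpace H] (hU : IsUnitaryRep U)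
    {K : Submodule ℂ H} {n : ℕ} (hK : HasHomogeneousSpectrum U K n) :
    ∃ (φ : ℤ × ℤ → ℂ) (a : Fin n → H), HasDiagonalCorrelation U φ a ∧ cyclicSum U a = K := by
  obtain ⟨one_le_n, C, hC, ortho, iSup_eq, iso⟩ := hK
  let e := finEquivCastLT n
  have n_pos : 0 < n := by exact_mod_cast one_le_n
  obtain ⟨h, hh⟩ := hC (e ⟨0, n_pos⟩)
  choose a span_a corr_a using fun i =>
    hU.exists_generator_of_restrictionsIsomorphic (hh.symm ▸ iso (e ⟨0, n_pos⟩) (e i))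
  refine ⟨fun z => inner ℂ (U z h) h, a, ⟨fun z i => corr_a i z, fun z i j hij => ?_⟩, ?_⟩
  · refine (ortho (e.injective.ne hij)).inner_eq ?_ ?_
    · exact span_a i ▸ apply_mem_cyclicSpan z _
    · exact span_a j ▸ hU.self_mem_cyclicSpan _
  · simp only [cyclicSum, span_a, e.iSup_comp (g := C), iSup_eq]

/-! ### Disjointness and multiplicity sets -/

theorem IsUnitaryRep.restrictionsDisjoint (hU : IsUnitaryRep U) {K L : Submodule ℂ H}
    [K.HasOrthogonalProjection] (hK : ∀ z, ∀ x ∈ K, U z x ∈ K)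
    (hKL : ∀ J : H →L[ℂ] H, (∀ z, Commute J (U z)) → ∀ x ∈ K, ∀ y ∈ L, inner ℂ (J x) y = 0) :
    RestrictionsDisjoint U K L := by
  intro J hJ
  have commute_extension : ∀ z,
      Commute (L.subtypeL ∘L J ∘L K.orthogonalProjectionOnto) (U z) := fun z => by
    ext x
    exact hJ z (K.orthogonalProjectionOnto x) (K.orthogonalProjectionOnto (U z x))
      (DFunLike.congr_fun (hU.commute_starProjection hK z).eq x)
  ext x
  have inner_self_eq_zero' := hKL _ commute_extension x x.2 (J x) (J x).2
  simpa using inner_self_eq_zero'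

theorem IsUnitaryRep.restrictionsDisjoint_symm [CompleteSpace H] (hU : IsUnitaryRep U)
    {K L : Submodule ℂ H} [L.HasOrthogonalProjection] (hL : ∀ z, ∀ y ∈ L, U z y ∈ L)
    (hKL : ∀ J : H →L[ℂ] H, (∀ z, Commute J (U z)) → ∀ x ∈ K, ∀ y ∈ L, inner ℂ (J x) y = 0) :
    RestrictionsDisjoint U L K := by
  refine hU.restrictionsDisjoint hL fun J hJ y hy x hx => ?_
  rw [← ContinuousLinearMap.adjoint_inner_right, inner_eq_zero_symm]
  exact hKL _ (hU.commute_star hJ) x hx y hy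

theorem hasMultiplicitySet_pair {K P Q : Submodule ℂ H} {m n : ℕ∞} (hmn : m ≠ n)
    (hP : P ≠ ⊥) (hQ : Q ≠ ⊥) (hPm : HasHomogeneousSpectrum U P m)
    (hQn : HasHomogeneousSpectrum U Q n) (ortho : P ⟂ Q) (disjoint : RestrictionsDisjoint U P Q)
    (disjoint' : RestrictionsDisjoint U Q P) (hK : (P ⊔ Q).topologicalClosure = K) :
    HasMultiplicitySet U K {m, n} := by
  classical
  refine ⟨fun k => if k.1 = m then P else Q, ?_, ?_, ?_, ?_, ?_⟩
  · rintro ⟨_, rfl | rfl⟩ <;> simp [hmn.symm, hP, hQ]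
  · rintro ⟨_, rfl | rfl⟩ <;> simp [hmn.symm, hPm, hQn]
  · rintro ⟨_, rfl | rfl⟩ ⟨_, rfl | rfl⟩ hne <;> simp [hmn.symm, ortho, ortho.symm] at hne ⊢
  · rintro ⟨_, rfl | rfl⟩ ⟨_, rfl | rfl⟩ hne <;> simp [hmn.symm, disjoint, disjoint'] at hne ⊢
  · simp [← hK, iSup_subtype, iSup_or, iSup_sup_eq, hmn.symm]

/-! ### Operators commuting with weak limits -/

theorem tendsto_apply_of_span_dense {E F : Type*} [NormedAddCommGroup E] [NormedSpace ℂ E]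
    [NormedAddCommGroup F] [NormedSpace ℂ F] {A : ℕ → E →L[ℂ] F} {B : E →L[ℂ] F} {C : ℝ}
    (hA : ∀ i, ‖A i‖ ≤ C) {S : Set E} (hS : (Submodule.span ℂ S).topologicalClosure = ⊤)
    (hAB : ∀ x ∈ S, Tendsto (fun i => A i x) atTop (𝓝 (B x))) (x : E) :
    Tendsto (fun i => A i x) atTop (𝓝 (B x)) := by
  let K : Submodule ℂ E :=
    { carrier := {x | Tendsto (fun i => A i x) atTop (𝓝 (B x))}
      zero_mem' := by simp
      add_mem' := fun {x y} hx hy => by simpa using Tendsto.add hx hy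
      smul_mem' := fun c x hx => by simpa using Tendsto.const_smul hx c }
  have isClosed_K : IsClosed (K : Set E) :=
    (LipschitzWith.uniformEquicontinuous (fun i => A i) C.toNNReal fun i =>
      (A i).lipschitz.weaken
        (NNReal.coe_le_coe.1 ((hA i).trans (Real.le_coe_toNNReal C)))).equicontinuous
      |>.isClosed_setOfPred_tendsto B.continuous
  have top_le : ⊤ ≤ K :=
    hS ▸ Submodule.topologicalClosure_minimal _ (Submodule.span_le.2 hAB) isClosed_K
  exact top_le Submodule.mem_top

theorem weakOperatorTendsto_of_span_dense {A : ℕ → H →L[ℂ] H} {B : H →L[ℂ] H} {C : ℝ}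
    (hA : ∀ i, ‖A i‖ ≤ C) {S : Set H} (hS : (Submodule.span ℂ S).topologicalClosure = ⊤)
    (hAB : ∀ f ∈ S, ∀ g ∈ S, Tendsto (fun i => inner ℂ (A i f) g) atTop (𝓝 (inner ℂ (B f) g))) :
    WeakOperatorTendsto A B := by
  have tendsto_left : ∀ g ∈ S, ∀ f, Tendsto (fun i => inner ℂ g (A i f)) atTop
      (𝓝 (inner ℂ g (B f))) := fun g hg =>
    tendsto_apply_of_span_dense (A := fun i => innerSL ℂ g ∘L A i) (B := innerSL ℂ g ∘L B)
      (C := ‖g‖ * C) (fun i => (ContinuousLinearMap.opNorm_comp_le _ _).trans (by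
        rw [innerSL_apply_norm]; gcongr; exact hA i)) hS fun f hf => by
          simpa [Function.comp_def] using (continuous_star.tendsto _).comp (hAB f hf g hg)
  intro f
  refine tendsto_apply_of_span_dense (A := fun i => innerSL ℂ (A i f)) (B := innerSL ℂ (B f))
    (C := C * ‖f‖) (fun i => ?_) hS fun g hg => ?_
  · rw [innerSL_apply_norm]
    exact (A i).le_of_opNorm_le (hA i) f
  · simpa [Function.comp_def] using (continuous_star.tendsto _).comp (tendsto_left g hg f)

theorem WeakOperatorTendsto.commute [CompleteSpace H] {A : ℕ → H →L[ℂ] H}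
    {B J : H →L[ℂ] H} (hA : WeakOperatorTendsto A B) (hJ : ∀ i, Commute J (A i)) : Commute J B := by
  ext x
  refine ext_inner_right ℂ fun y => ?_
  have tendsto_JA := hA x (ContinuousLinearMap.adjoint J y)
  simp only [ContinuousLinearMap.adjoint_inner_right] at tendsto_JA
  exact tendsto_nhds_unique tendsto_JA
    ((hA (J x) y).congr fun i => by rw [← mul_apply_eq_comp, ← (hJ i).eq, mul_apply_eq_comp])

end Families

theorem commute_of_commute_mul_nonneg {A : Type*} [CStarAlgebra A] [PartialOrder A]
    [StarOrderedRing A] {J N V : A} (hN : 0 ≤ N) (hN' : IsUnit N) (hV : star V * V = 1)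
    (hJ : Commute J (V * N)) (hJ' : Commute J (star (V * N))) : Commute J V := by
  have abs_eq : CFC.abs (V * N) = N := by
    rw [CFC.abs, star_mul, hN.isSelfAdjoint.star_eq, mul_assoc, ← mul_assoc (star V), hV, one_mul,
      CFC.sqrt_mul_self N]
  have commute_N : Commute J N := by
    rw [← abs_eq]
    exact (hJ.symm.cfcAbs_left (by simpa using hJ'.symm.star_star)).symm
  refine hN'.mul_right_cancel ?_
  rw [mul_assoc, hJ.eq, mul_assoc, mul_assoc, commute_N.eq]

/-- Stated for an abstract Hilbert space because instance search for the continuous functional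
calculus fails on operators on `Lp ℂ 2 μ`. -/
theorem exists_eq_star_mul_self_of_nonneg {H : Type*} [NormedAddCommGroup H]
    [InnerProductSpace ℂ H] [CompleteSpace H] {A : H →L[ℂ] H} (hA : 0 ≤ A) :
    ∃ B : H →L[ℂ] H, A = star B * B :=
  CStarAlgebra.nonneg_iff_eq_star_mul_self.1 hA

/-! ### Tensor products of bounded operators on `L²` -/

section TensorNorm

open TensorProduct

variable {𝕜 E E' F F' : Type*} [RCLike 𝕜]
  [NormedAddCommGroup E] [InnerProductSpace 𝕜 E] [NormedAddCommGroup E'] [InnerProductSpace 𝕜 E']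
  [NormedAddCommGroup F] [InnerProductSpace 𝕜 F] [NormedAddCommGroup F'] [InnerProductSpace 𝕜 F']

theorem norm_sq_sum_tmul {ι : Type*} [Fintype ι] (f : ι → E) {b : ι → F} (hb : Orthonormal 𝕜 b) :
    ‖∑ i, f i ⊗ₜ[𝕜] b i‖ ^ 2 = ∑ i, ‖f i‖ ^ 2 := by
  classical
  refine RCLike.ofReal_injective (K := 𝕜) ?_
  push_cast
  simp only [← inner_self_eq_norm_sq_to_K (𝕜 := 𝕜), sum_inner, inner_sum, inner_tmul,
    orthonormal_iff_ite.1 hb, mul_ite, mul_one, mul_zero, Finset.sum_ite_eq', Finset.mem_univ,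
    if_true]

theorem exists_orthonormal_sum_tmul_eq (x : E ⊗[𝕜] F) :
    ∃ (n : ℕ) (f : Fin n → E) (b : Fin n → F), Orthonormal 𝕜 b ∧ x = ∑ i, f i ⊗ₜ[𝕜] b i := by
  obtain ⟨E₀, F₀, _, _, hx⟩ := exists_finite_submodule_of_setFinite {x} (Set.finite_singleton x)
  obtain ⟨y, rfl⟩ := Set.singleton_subset_iff.mp hx
  let b := stdOrthonormalBasis 𝕜 F₀
  refine ⟨_, fun i => (equivFinsuppOfBasisRight b.toBasis y i : E), fun i => (b i : F),
    b.orthonormal.comp_linearIsometry F₀.subtypeₗᵢ, ?_⟩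
  conv_lhs => rw [← (equivFinsuppOfBasisRight b.toBasis).symm_apply_apply y]
  rw [equivFinsuppOfBasisRight_symm_apply, Finsupp.sum_fintype _ _ (by simp)]
  simp [mapIncl]

theorem norm_map_id_le (A : E →L[𝕜] E') (x : E ⊗[𝕜] F) :
    ‖map A.toLinearMap LinearMap.id x‖ ≤ ‖A‖ * ‖x‖ := by
  obtain ⟨n, f, b, hb, rfl⟩ := exists_orthonormal_sum_tmul_eq x
  rw [← sq_le_sq₀ (norm_nonneg _) (by positivity), mul_pow]
  simp only [map_sum, map_tmul, LinearMap.id_apply, ContinuousLinearMap.coe_coe]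
  rw [norm_sq_sum_tmul _ hb, norm_sq_sum_tmul _ hb, Finset.mul_sum]
  gcongr with i
  rw [← mul_pow]
  gcongr
  exact A.le_opNorm _

theorem norm_map_le (A : E →L[𝕜] E') (B : F →L[𝕜] F') (x : E ⊗[𝕜] F) :
    ‖map A.toLinearMap B.toLinearMap x‖ ≤ ‖A‖ * ‖B‖ * ‖x‖ := by
  have map_eq : map A.toLinearMap B.toLinearMap x =
      map A.toLinearMap LinearMap.id (TensorProduct.comm 𝕜 F' E
        (map B.toLinearMap LinearMap.id (TensorProduct.comm 𝕜 E F x))) := by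
    induction x with
    | zero => simp
    | tmul f g => simp
    | add x y hx hy => simp [hx, hy]
  rw [map_eq, mul_assoc]
  refine (norm_map_id_le A _).trans ?_
  gcongr
  rw [TensorProduct.norm_comm]
  refine (norm_map_id_le B _).trans ?_
  rw [TensorProduct.norm_comm]

end TensorNorm

section LpTensor

variable {X Y : Type*} [MeasurableSpace X] [MeasurableSpace Y] {μ : Measure X} {ν : Measure Y}

theorem ae_eq_zero_of_forall_setIntegral_prod_eq_zero {E : Type*} [NormedAddCommGroup E]
    [NormedSpace ℝ E] [CompleteSpace E] {F : X × Y → E} (hF : Integrable F (μ.prod ν))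
    (rect : ∀ s t, MeasurableSet s → MeasurableSet t → ∫ p in s ×ˢ t, F p ∂μ.prod ν = 0) :
    F =ᵐ[μ.prod ν] 0 := by
  suffices setIntegral : ∀ s, MeasurableSet s → ∫ p in s, F p ∂μ.prod ν = 0 from
    hF.ae_eq_zero_of_forall_setIntegral_eq_zero fun s hs _ => setIntegral s hs
  intro s hs
  induction s, hs using MeasurableSpace.induction_on_inter generateFrom_prod.symm
    isPiSystem_prod with
  | empty => simp
  | basic _ hst =>
    obtain ⟨s, hs, t, ht, rfl⟩ := hst
    exact rect s t hs ht
  | compl s hs ih =>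
    have integral_compl := integral_add_compl hs hF
    rw [ih, zero_add] at integral_compl
    rw [integral_compl, ← setIntegral_univ, ← Set.univ_prod_univ]
    exact rect _ _ .univ .univ
  | iUnion s disjoint meas ih =>
    rw [integral_iUnion meas disjoint hF.integrableOn]
    simp [ih]

theorem memLp_tmul (f : Lp ℂ 2 μ) (g : Lp ℂ 2 ν) :
    MemLp (fun p : X × Y => f p.1 * g p.2) 2 (μ.prod ν) := by
  have sm_mul : AEStronglyMeasurable (fun p : X × Y => f p.1 * g p.2) (μ.prod ν) :=
    (Lp.aestronglyMeasurable f).comp_fst.mul (Lp.aestronglyMeasurable g).comp_snd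
  rw [memLp_two_iff_integrable_sq_norm sm_mul]
  simpa only [norm_mul, mul_pow] using
    ((memLp_two_iff_integrable_sq_norm (Lp.aestronglyMeasurable f)).1 (Lp.memLp f)).mul_prod
      ((memLp_two_iff_integrable_sq_norm (Lp.aestronglyMeasurable g)).1 (Lp.memLp g))

/-- The function `f(x) g(y)`, bilinearly in `f` and `g`. -/
def lpTmul : Lp ℂ 2 μ →ₗ[ℂ] Lp ℂ 2 ν →ₗ[ℂ] Lp ℂ 2 (μ.prod ν) :=
  LinearMap.mk₂ ℂ (fun f g => (memLp_tmul f g).toLp _)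
    (fun f f' g => by
      rw [← MemLp.toLp_add]
      refine MemLp.toLp_congr _ _ ?_
      filter_upwards [Measure.quasiMeasurePreserving_fst.ae (Lp.coeFn_add f f')] with p hp
      simp only [hp, Pi.add_apply, add_mul])
    (fun c f g => by
      rw [← MemLp.toLp_const_smul]
      refine MemLp.toLp_congr _ _ ?_
      filter_upwards [Measure.quasiMeasurePreserving_fst.ae (Lp.coeFn_smul c f)] with p hp
      simp only [hp, Pi.smul_apply, smul_eq_mul, mul_assoc])
    (fun f g g' => by
      rw [← MemLp.toLp_add]
      refine MemLp.toLp_congr _ _ ?_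
      filter_upwards [Measure.quasiMeasurePreserving_snd.ae (Lp.coeFn_add g g')] with p hp
      simp only [hp, Pi.add_apply, mul_add])
    (fun c f g => by
      rw [← MemLp.toLp_const_smul]
      refine MemLp.toLp_congr _ _ ?_
      filter_upwards [Measure.quasiMeasurePreserving_snd.ae (Lp.coeFn_smul c g)] with p hp
      simp only [hp, Pi.smul_apply, smul_eq_mul, mul_left_comm])

theorem coeFn_lpTmul (f : Lp ℂ 2 μ) (g : Lp ℂ 2 ν) :
    lpTmul f g =ᵐ[μ.prod ν] fun p => f p.1 * g p.2 :=
  MemLp.coeFn_toLp (memLp_tmul f g)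

section SFinite

variable [SFinite μ] [SFinite ν]

theorem inner_lpTmul (f f' : Lp ℂ 2 μ) (g g' : Lp ℂ 2 ν) :
    inner ℂ (lpTmul f g) (lpTmul f' g') = inner ℂ f f' * inner ℂ g g' := by
  rw [L2.inner_def, L2.inner_def, L2.inner_def, ← integral_prod_mul]
  refine integral_congr_ae ?_
  filter_upwards [coeFn_lpTmul f g, coeFn_lpTmul f' g'] with p hfg hfg'
  simp only [hfg, hfg', RCLike.inner_apply, map_mul]
  ring

variable (μ ν) in
/-- The isometric embedding of the algebraic tensor product into `L²` of the product. -/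
def lpTensor : TensorProduct ℂ (Lp ℂ 2 μ) (Lp ℂ 2 ν) →ₗᵢ[ℂ] Lp ℂ 2 (μ.prod ν) :=
  (TensorProduct.lift lpTmul).isometryOfInner fun x y => by
    induction x with
    | zero => simp
    | add x x' hx hx' => simp [inner_add_left, hx, hx']
    | tmul f g =>
      induction y with
      | zero => simp
      | add y y' hy hy' => simp only [map_add, inner_add_right, hy, hy']
      | tmul f' g' => simp [inner_lpTmul]

theorem lpTensor_tmul (f : Lp ℂ 2 μ) (g : Lp ℂ 2 ν) :
    lpTensor μ ν (f ⊗ₜ[ℂ] g) = lpTmul f g := by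
  simp [lpTensor]

theorem norm_lpTmul (f : Lp ℂ 2 μ) (g : Lp ℂ 2 ν) : ‖lpTmul f g‖ = ‖f‖ * ‖g‖ := by
  rw [← lpTensor_tmul, LinearIsometry.norm_map, TensorProduct.norm_tmul]

theorem lpTmul_ne_zero {f : Lp ℂ 2 μ} {g : Lp ℂ 2 ν} (hf : f ≠ 0) (hg : g ≠ 0) :
    lpTmul f g ≠ 0 := by
  rw [← norm_ne_zero_iff, norm_lpTmul]
  exact mul_ne_zero (norm_ne_zero_iff.2 hf) (norm_ne_zero_iff.2 hg)

/-- `lpTmul` as a continuous bilinear map. -/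
def lpTmulL : Lp ℂ 2 μ →L[ℂ] Lp ℂ 2 ν →L[ℂ] Lp ℂ 2 (μ.prod ν) :=
  lpTmul.mkContinuous₂ 1 fun f g => by rw [norm_lpTmul, one_mul]

end SFinite

variable [IsFiniteMeasure μ] [IsFiniteMeasure ν]

theorem lpTmul_indicatorConstLp_one {s : Set X} {t : Set Y} (hs : MeasurableSet s)
    (ht : MeasurableSet t) :
    lpTmul (indicatorConstLp 2 hs (measure_ne_top μ s) (1 : ℂ))
        (indicatorConstLp 2 ht (measure_ne_top ν t) (1 : ℂ)) =
      indicatorConstLp 2 (hs.prod ht) (measure_ne_top (μ.prod ν) _) (1 : ℂ) := by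
  refine Lp.ext ?_
  filter_upwards [coeFn_lpTmul (indicatorConstLp 2 hs (measure_ne_top μ s) (1 : ℂ))
      (indicatorConstLp 2 ht (measure_ne_top ν t) (1 : ℂ)),
    Measure.quasiMeasurePreserving_fst.ae
      (indicatorConstLp_coeFn (p := 2) (hs := hs) (hμs := measure_ne_top μ s) (c := (1 : ℂ))),
    Measure.quasiMeasurePreserving_snd.ae
      (indicatorConstLp_coeFn (p := 2) (hs := ht) (hμs := measure_ne_top ν t) (c := (1 : ℂ))),
    indicatorConstLp_coeFn (p := 2) (hs := hs.prod ht)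
      (hμs := measure_ne_top (μ.prod ν) _) (c := (1 : ℂ))] with p h_tmul h_fst h_snd h_prod
  rw [h_tmul, h_fst, h_snd, h_prod]
  by_cases hp : p.1 ∈ s <;> by_cases hq : p.2 ∈ t <;> simp [Set.indicator, hp, hq]

theorem eq_zero_of_inner_lpTmul {F : Lp ℂ 2 (μ.prod ν)}
    (hF : ∀ (f : Lp ℂ 2 μ) (g : Lp ℂ 2 ν), inner ℂ (lpTmul f g) F = 0) : F = 0 := by
  refine (Lp.eq_zero_iff_ae_eq_zero).2 (ae_eq_zero_of_forall_setIntegral_prod_eq_zero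
    ((Lp.memLp F).integrable one_le_two) fun s t hs ht => ?_)
  rw [← L2.inner_indicatorConstLp_one (𝕜 := ℂ) (hs.prod ht) (measure_ne_top (μ.prod ν) _) F,
    ← lpTmul_indicatorConstLp_one hs ht]
  exact hF _ _

theorem span_lpTmul_dense :
    (Submodule.span ℂ (Set.range fun p : Lp ℂ 2 μ × Lp ℂ 2 ν =>
      lpTmul p.1 p.2)).topologicalClosure = ⊤ := by
  rw [Submodule.topologicalClosure_eq_top_iff, Submodule.eq_bot_iff]
  exact fun F hF => eq_zero_of_inner_lpTmul fun f g =>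
    (Submodule.mem_orthogonal _ _).1 hF _ (Submodule.subset_span ⟨(f, g), rfl⟩)

theorem ext_lpTmul {E : Type*} [NormedAddCommGroup E] [NormedSpace ℂ E]
    {A B : Lp ℂ 2 (μ.prod ν) →L[ℂ] E} (hAB : ∀ f g, A (lpTmul f g) = B (lpTmul f g)) :
    A = B := by
  refine ContinuousLinearMap.ext_on
    ((Submodule.dense_iff_topologicalClosure_eq_top).2 span_lpTmul_dense) ?_
  rintro _ ⟨⟨f, g⟩, rfl⟩
  exact hAB f g

theorem denseRange_lpTensor : DenseRange (lpTensor μ ν) := by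
  change Dense ((lpTensor μ ν).toLinearMap.range : Set (Lp ℂ 2 (μ.prod ν)))
  rw [Submodule.dense_iff_topologicalClosure_eq_top, eq_top_iff, ← span_lpTmul_dense]
  refine Submodule.topologicalClosure_mono (Submodule.span_le.2 ?_)
  rintro _ ⟨⟨f, g⟩, rfl⟩
  exact ⟨_, lpTensor_tmul f g⟩

/-- The operator `A ⊗ B` on `L²(μ × ν)`. -/
def opTensor (A : Lp ℂ 2 μ →L[ℂ] Lp ℂ 2 μ) (B : Lp ℂ 2 ν →L[ℂ] Lp ℂ 2 ν) :
    Lp ℂ 2 (μ.prod ν) →L[ℂ] Lp ℂ 2 (μ.prod ν) :=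
  ((lpTensor μ ν).toLinearMap ∘ₗ TensorProduct.map A.toLinearMap B.toLinearMap).extendOfNorm
    (lpTensor μ ν).toLinearMap

theorem norm_lpTensor_map_le (A : Lp ℂ 2 μ →L[ℂ] Lp ℂ 2 μ) (B : Lp ℂ 2 ν →L[ℂ] Lp ℂ 2 ν)
    (x : TensorProduct ℂ (Lp ℂ 2 μ) (Lp ℂ 2 ν)) :
    ‖((lpTensor μ ν).toLinearMap ∘ₗ TensorProduct.map A.toLinearMap B.toLinearMap) x‖ ≤
      ‖A‖ * ‖B‖ * ‖(lpTensor μ ν).toLinearMap x‖ := by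
  simpa using norm_map_le A B x

theorem opTensor_lpTmul (A : Lp ℂ 2 μ →L[ℂ] Lp ℂ 2 μ) (B : Lp ℂ 2 ν →L[ℂ] Lp ℂ 2 ν)
    (f : Lp ℂ 2 μ) (g : Lp ℂ 2 ν) : opTensor A B (lpTmul f g) = lpTmul (A f) (B g) := by
  simpa [lpTensor_tmul, opTensor] using LinearMap.extendOfNorm_eq
    denseRange_lpTensor ⟨_, norm_lpTensor_map_le A B⟩ (f ⊗ₜ[ℂ] g)

theorem norm_opTensor_le (A : Lp ℂ 2 μ →L[ℂ] Lp ℂ 2 μ) (B : Lp ℂ 2 ν →L[ℂ] Lp ℂ 2 ν) :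
    ‖opTensor A B‖ ≤ ‖A‖ * ‖B‖ :=
  LinearMap.opNorm_extendOfNorm_le denseRange_lpTensor (by positivity) (norm_lpTensor_map_le A B)

theorem opTensor_mul (A A' : Lp ℂ 2 μ →L[ℂ] Lp ℂ 2 μ) (B B' : Lp ℂ 2 ν →L[ℂ] Lp ℂ 2 ν) :
    opTensor A B * opTensor A' B' = opTensor (A * A') (B * B') :=
  ext_lpTmul fun f g => by simp only [mul_apply_eq_comp, opTensor_lpTmul]

theorem opTensor_one :
    opTensor (1 : Lp ℂ 2 μ →L[ℂ] Lp ℂ 2 μ) (1 : Lp ℂ 2 ν →L[ℂ] Lp ℂ 2 ν) = 1 :=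
  ext_lpTmul fun f g => by simp only [opTensor_lpTmul, one_apply_eq_self]

theorem star_opTensor (A : Lp ℂ 2 μ →L[ℂ] Lp ℂ 2 μ) (B : Lp ℂ 2 ν →L[ℂ] Lp ℂ 2 ν) :
    star (opTensor A B) = opTensor (star A) (star B) := by
  refine ext_lpTmul fun f g => sub_eq_zero.1 (eq_zero_of_inner_lpTmul fun f' g' => ?_)
  simp only [ContinuousLinearMap.star_eq_adjoint, inner_sub_right, opTensor_lpTmul, inner_lpTmul,
    ContinuousLinearMap.adjoint_inner_right, sub_self]

theorem inner_opTensor_opTensor {A : Lp ℂ 2 μ →L[ℂ] Lp ℂ 2 μ} {B : Lp ℂ 2 ν →L[ℂ] Lp ℂ 2 ν}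
    (hA : star A * A = 1) (hB : star B * B = 1) (x y : Lp ℂ 2 (μ.prod ν)) :
    inner ℂ (opTensor A B x) (opTensor A B y) = inner ℂ x y := by
  rw [← ContinuousLinearMap.adjoint_inner_right, ← ContinuousLinearMap.star_eq_adjoint,
    ← mul_apply_eq_comp, star_opTensor, opTensor_mul, hA, hB, opTensor_one, one_apply_eq_self]

theorem opTensor_nonneg {A : Lp ℂ 2 μ →L[ℂ] Lp ℂ 2 μ} {B : Lp ℂ 2 ν →L[ℂ] Lp ℂ 2 ν}
    (hA : 0 ≤ A) (hB : 0 ≤ B) : 0 ≤ opTensor A B := by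
  obtain ⟨C, rfl⟩ := exists_eq_star_mul_self_of_nonneg hA
  obtain ⟨D, rfl⟩ := exists_eq_star_mul_self_of_nonneg hB
  rw [← opTensor_mul, ← star_opTensor]
  exact star_mul_self_nonneg _

theorem isUnit_opTensor {A : Lp ℂ 2 μ →L[ℂ] Lp ℂ 2 μ} {B : Lp ℂ 2 ν →L[ℂ] Lp ℂ 2 ν}
    (hA : IsUnit A) (hB : IsUnit B) : IsUnit (opTensor A B) := by
  obtain ⟨A', mul_A', A'_mul⟩ := isUnit_iff_exists.1 hA
  obtain ⟨B', mul_B', B'_mul⟩ := isUnit_iff_exists.1 hB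
  refine isUnit_iff_exists.2 ⟨opTensor A' B', ?_, ?_⟩
  · rw [opTensor_mul, mul_A', mul_B', opTensor_one]
  · rw [opTensor_mul, A'_mul, B'_mul, opTensor_one]

theorem WeakOperatorTendsto.opTensor {A : ℕ → Lp ℂ 2 μ →L[ℂ] Lp ℂ 2 μ}
    {A' : Lp ℂ 2 μ →L[ℂ] Lp ℂ 2 μ} {B : ℕ → Lp ℂ 2 ν →L[ℂ] Lp ℂ 2 ν}
    {B' : Lp ℂ 2 ν →L[ℂ] Lp ℂ 2 ν} (hA : WeakOperatorTendsto A A')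
    (hB : WeakOperatorTendsto B B') (hA1 : ∀ i, ‖A i‖ ≤ 1) (hB1 : ∀ i, ‖B i‖ ≤ 1) :
    WeakOperatorTendsto (fun i => opTensor (A i) (B i)) (opTensor A' B') := by
  refine weakOperatorTendsto_of_span_dense (C := 1) (fun i => (norm_opTensor_le _ _).trans
    (mul_le_one₀ (hA1 i) (norm_nonneg _) (hB1 i))) span_lpTmul_dense ?_
  rintro _ ⟨⟨f, g⟩, rfl⟩ _ ⟨⟨f', g'⟩, rfl⟩
  simpa only [opTensor_lpTmul, inner_lpTmul] using (hA f f').mul (hB g g')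

end LpTensor

/-! ### Koopman operators and weak mixing -/

section Constants

variable {X Y : Type*} [MeasurableSpace X] [MeasurableSpace Y] {μ : Measure X} {ν : Measure Y}
  [IsProbabilityMeasure μ] [IsProbabilityMeasure ν]

variable (μ) in
/-- The constant function `1` as an element of `L²(μ)`. -/
abbrev lpOne : Lp ℂ 2 μ := Lp.const 2 μ (1 : ℂ)

theorem norm_lpOne : ‖lpOne μ‖ = 1 := by
  rw [lpOne, Lp.norm_const]
  · simp
  · exact two_ne_zero

theorem lpOne_ne_zero : lpOne μ ≠ 0 :=
  norm_ne_zero_iff.1 (norm_lpOne.trans_ne one_ne_zero)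

theorem inner_lpOne_self : inner ℂ (lpOne μ) (lpOne μ) = 1 := by
  rw [inner_self_eq_norm_sq_to_K, norm_lpOne]
  simp

theorem mem_constSubspace_iff {f : Lp ℂ 2 μ} :
    f ∈ constSubspace μ ↔ ∀ k ∈ L2Zero μ, inner ℂ k f = 0 := by
  rw [← (constSubspace μ).orthogonal_orthogonal]
  rfl

theorem mem_L2Zero_iff {f : Lp ℂ 2 μ} : f ∈ L2Zero μ ↔ inner ℂ (lpOne μ) f = 0 :=
  Submodule.mem_orthogonal_singleton_iff_inner_right

theorem isClosed_L2Zero : IsClosed (L2Zero μ : Set (Lp ℂ 2 μ)) :=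
  Submodule.isClosed_orthogonal _

theorem constProj_apply (f : Lp ℂ 2 μ) : constProj μ f = inner ℂ (lpOne μ) f • lpOne μ :=
  Submodule.starProjection_unit_singleton ℂ norm_lpOne f

theorem lpTmul_lpOne : lpTmul (lpOne μ) (lpOne ν) = lpOne (μ.prod ν) := by
  refine Lp.ext ?_
  filter_upwards [coeFn_lpTmul (lpOne μ) (lpOne ν),
    Measure.quasiMeasurePreserving_fst.ae (Lp.coeFn_const 2 μ (1 : ℂ)),
    Measure.quasiMeasurePreserving_snd.ae (Lp.coeFn_const 2 ν (1 : ℂ)),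
    Lp.coeFn_const 2 (μ.prod ν) (1 : ℂ)] with p h_tmul h_fst h_snd h_prod
  rw [h_tmul, h_fst, h_snd, h_prod]
  simp

theorem lpTmul_mem_L2Zero_left {f : Lp ℂ 2 μ} (hf : f ∈ L2Zero μ) (g : Lp ℂ 2 ν) :
    lpTmul f g ∈ L2Zero (μ.prod ν) := by
  rw [mem_L2Zero_iff, ← lpTmul_lpOne, inner_lpTmul, mem_L2Zero_iff.1 hf, zero_mul]

theorem lpTmul_mem_L2Zero_right (f : Lp ℂ 2 μ) {g : Lp ℂ 2 ν} (hg : g ∈ L2Zero ν) :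
    lpTmul f g ∈ L2Zero (μ.prod ν) := by
  rw [mem_L2Zero_iff, ← lpTmul_lpOne, inner_lpTmul, mem_L2Zero_iff.1 hg, mul_zero]

theorem mem_constSubspace_of_lpTmul_left {f : Lp ℂ 2 μ} {g : Lp ℂ 2 ν} (hg : g ≠ 0)
    (hfg : lpTmul f g ∈ constSubspace (μ.prod ν)) : f ∈ constSubspace μ := by
  refine mem_constSubspace_iff.2 fun k hk => ?_
  have inner_tmul_eq_zero := mem_constSubspace_iff.1 hfg _ (lpTmul_mem_L2Zero_left hk g)
  rw [inner_lpTmul] at inner_tmul_eq_zero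
  exact (mul_eq_zero.1 inner_tmul_eq_zero).resolve_right (inner_self_ne_zero.2 hg)

theorem mem_constSubspace_of_lpTmul_right {f : Lp ℂ 2 μ} {g : Lp ℂ 2 ν} (hf : f ≠ 0)
    (hfg : lpTmul f g ∈ constSubspace (μ.prod ν)) : g ∈ constSubspace ν := by
  refine mem_constSubspace_iff.2 fun k hk => ?_
  have inner_tmul_eq_zero := mem_constSubspace_iff.1 hfg _ (lpTmul_mem_L2Zero_right f hk)
  rw [inner_lpTmul] at inner_tmul_eq_zero
  exact (mul_eq_zero.1 inner_tmul_eq_zero).resolve_left (inner_self_ne_zero.2 hf)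

theorem eq_zero_of_mem_constSubspace_of_mem_L2Zero {f : Lp ℂ 2 μ} (hf : f ∈ constSubspace μ)
    (hf' : f ∈ L2Zero μ) : f = 0 :=
  inner_self_eq_zero.1 (Submodule.inner_right_of_mem_orthogonal hf hf')

end Constants

section Koopman

variable {X Y : Type*} [MeasurableSpace X] [MeasurableSpace Y] {μ : Measure X} {ν : Measure Y}

theorem compMeasurePreserving_congr {f f' : X → X} (hf : MeasurePreserving f μ μ)
    (hf' : MeasurePreserving f' μ μ) (h : f =ᵐ[μ] f') (g : Lp ℂ 2 μ) :
    Lp.compMeasurePreserving f hf g = Lp.compMeasurePreserving f' hf' g := by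
  refine Lp.ext ?_
  filter_upwards [Lp.coeFn_compMeasurePreserving g hf, Lp.coeFn_compMeasurePreserving g hf', h]
    with x h_comp h_comp' h_eq
  rw [h_comp, h_comp', Function.comp_apply, Function.comp_apply, h_eq]

theorem compMeasurePreserving_lpTmul [SFinite μ] [SFinite ν] {S : X → X} {T : Y → Y}
    (hS : MeasurePreserving S μ μ) (hT : MeasurePreserving T ν ν)
    (f : Lp ℂ 2 μ) (g : Lp ℂ 2 ν) :
    Lp.compMeasurePreserving (Prod.map S T) (hS.prod hT) (lpTmul f g) =
      lpTmul (Lp.compMeasurePreserving S hS f) (Lp.compMeasurePreserving T hT g) := by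
  refine Lp.ext ?_
  filter_upwards [Lp.coeFn_compMeasurePreserving (lpTmul f g) (hS.prod hT),
    coeFn_lpTmul (Lp.compMeasurePreserving S hS f) (Lp.compMeasurePreserving T hT g),
    (hS.prod hT).quasiMeasurePreserving.ae (coeFn_lpTmul f g),
    Measure.quasiMeasurePreserving_fst.ae (Lp.coeFn_compMeasurePreserving f hS),
    Measure.quasiMeasurePreserving_snd.ae (Lp.coeFn_compMeasurePreserving g hT)]
    with p h_comp h_tmul h_tmul_map h_fst h_snd
  rw [h_comp, h_tmul, Function.comp_apply, h_tmul_map, h_fst, h_snd]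
  rfl

theorem star_compMeasurePreserving {S : X → X} (hS : MeasurePreserving S μ μ) (f : Lp ℂ 2 μ) :
    star (Lp.compMeasurePreserving S hS f) = Lp.compMeasurePreserving S hS (star f) := by
  refine Lp.ext ?_
  filter_upwards [Lp.coeFn_star (Lp.compMeasurePreserving S hS f),
    Lp.coeFn_compMeasurePreserving f hS, Lp.coeFn_compMeasurePreserving (star f) hS,
    hS.quasiMeasurePreserving.ae (Lp.coeFn_star f)] with x h_star h_comp h_comp' h_star_map
  rw [h_star, Pi.star_apply, h_comp, h_comp', Function.comp_apply, Function.comp_apply,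
    h_star_map, Pi.star_apply]

theorem inner_star_star (f g : Lp ℂ 2 μ) :
    inner ℂ (star f) (star g) = starRingEnd ℂ (inner ℂ f g) := by
  rw [L2.inner_def, L2.inner_def, ← integral_conj]
  refine integral_congr_ae ?_
  filter_upwards [Lp.coeFn_star f, Lp.coeFn_star g] with x hf hg
  simp [hf, hg]

namespace Z2Action

theorem isUnitaryRep_koopman (S : Z2Action μ) : IsUnitaryRep S.koopman where
  map_zero := by
    ext1 g
    exact (compMeasurePreserving_congr _ (.id μ) S.map_zero g).trans (by simp)
  map_add z z' := by
    ext1 g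
    rw [add_comm]
    exact (compMeasurePreserving_congr _ _ (S.map_add z' z).symm g).trans
      (Lp.compMeasurePreserving_comp_apply ..)
  inner_map_map z := LinearIsometry.inner_map_map _

theorem norm_koopman_le (S : Z2Action μ) (z : ℤ × ℤ) : ‖S.koopman z‖ ≤ 1 :=
  LinearIsometry.norm_toContinuousLinearMap_le _

theorem koopman_star (S : Z2Action μ) (z : ℤ × ℤ) (f : Lp ℂ 2 μ) :
    S.koopman z (star f) = star (S.koopman z f) :=
  (star_compMeasurePreserving (S.measurePreserving z) f).symm

theorem koopman_prod_lpTmul [SFinite μ] [SFinite ν] (S : Z2Action μ) (T : Z2Action ν) (z : ℤ × ℤ)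
    (f : Lp ℂ 2 μ) (g : Lp ℂ 2 ν) :
    (S.prod T).koopman z (lpTmul f g) = lpTmul (S.koopman z f) (T.koopman z g) :=
  compMeasurePreserving_lpTmul (S.measurePreserving z) (T.measurePreserving z) f g

theorem koopman_prod [IsFiniteMeasure μ] [IsFiniteMeasure ν] (S : Z2Action μ) (T : Z2Action ν)
    (z : ℤ × ℤ) : (S.prod T).koopman z = opTensor (S.koopman z) (T.koopman z) :=
  ext_lpTmul fun f g => by rw [opTensor_lpTmul, koopman_prod_lpTmul]

variable [IsProbabilityMeasure μ] [IsProbabilityMeasure ν]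

theorem koopman_lpOne (S : Z2Action μ) (z : ℤ × ℤ) : S.koopman z (lpOne μ) = lpOne μ := by
  refine Lp.ext ?_
  filter_upwards [Lp.coeFn_compMeasurePreserving (lpOne μ) (S.measurePreserving z),
    (S.measurePreserving z).quasiMeasurePreserving.ae (Lp.coeFn_const 2 μ (1 : ℂ)),
    Lp.coeFn_const 2 μ (1 : ℂ)] with x h_comp h_const_map h_const
  exact h_comp.trans (h_const_map.trans h_const.symm)

theorem koopman_mem_L2Zero (S : Z2Action μ) (z : ℤ × ℤ) {f : Lp ℂ 2 μ} (hf : f ∈ L2Zero μ) :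
    S.koopman z f ∈ L2Zero μ := by
  rw [mem_L2Zero_iff, ← S.koopman_lpOne z, S.isUnitaryRep_koopman.inner_map_map]
  exact mem_L2Zero_iff.1 hf

theorem koopman_sub_mem_L2Zero (S : Z2Action μ) (z : ℤ × ℤ) (f : Lp ℂ 2 μ) :
    S.koopman z f - f ∈ L2Zero μ := by
  rw [mem_L2Zero_iff, inner_sub_right, sub_eq_zero]
  conv_lhs => rw [← S.koopman_lpOne z]
  exact S.isUnitaryRep_koopman.inner_map_map z _ _

/-- The only functions in `L²` invariant under `S^z` are the constants; equivalently, `S^z` is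
ergodic. -/
def FixesOnlyConstants (S : Z2Action μ) (z : ℤ × ℤ) : Prop :=
  ∀ f, S.koopman z f = f → f ∈ constSubspace μ

theorem fixesOnlyConstants_of_ergodic {S : Z2Action μ} {z : ℤ × ℤ} (hS : Ergodic (S.map z) μ) :
    S.FixesOnlyConstants z := by
  intro f hf
  have map_ae_eq : S.koopman z f =ᵐ[μ] f ∘ S.map z :=
    Lp.coeFn_compMeasurePreserving f (S.measurePreserving z)
  rw [hf] at map_ae_eq
  obtain ⟨c, hc⟩ := hS.ae_eq_const_of_ae_eq_comp_ae (Lp.aestronglyMeasurable f) map_ae_eq.symm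
  refine Submodule.mem_span_singleton.2 ⟨c, Lp.ext ?_⟩
  filter_upwards [hc, Lp.coeFn_smul c (lpOne μ), Lp.coeFn_const 2 μ (1 : ℂ)]
    with x h_eq h_smul h_const
  rw [h_eq, h_smul, Pi.smul_apply, h_const]
  simp

namespace FixesOnlyConstants

variable {S : Z2Action μ} {T : Z2Action ν} {z : ℤ × ℤ}

theorem eq_zero (hS : S.FixesOnlyConstants z) {f : Lp ℂ 2 μ} (hf : S.koopman z f = f)
    (hf' : f ∈ L2Zero μ) : f = 0 :=
  eq_zero_of_mem_constSubspace_of_mem_L2Zero (hS f hf) hf'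

theorem fst (h : (S.prod T).FixesOnlyConstants z) : S.FixesOnlyConstants z := fun f hf =>
  mem_constSubspace_of_lpTmul_left (lpOne_ne_zero (μ := ν)) <|
    h _ (by rw [koopman_prod_lpTmul, hf, koopman_lpOne])

theorem snd (h : (S.prod T).FixesOnlyConstants z) : T.FixesOnlyConstants z := fun g hg =>
  mem_constSubspace_of_lpTmul_right (lpOne_ne_zero (μ := μ)) <|
    h _ (by rw [koopman_prod_lpTmul, hg, koopman_lpOne])

theorem inner_map_eq_zero {E : Type*} [NormedAddCommGroup E] [InnerProductSpace ℂ E]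
    [CompleteSpace E] (hS : S.FixesOnlyConstants z) {A : E → E} {B : Lp ℂ 2 μ →L[ℂ] E}
    (hA : ∀ x y, inner ℂ (A x) (A y) = inner ℂ x y) (hAB : ∀ f, A (B f) = B (S.koopman z f))
    {y : E} (hy : A y = y) {k : Lp ℂ 2 μ} (hk : k ∈ L2Zero μ) : inner ℂ (B k) y = 0 := by
  rw [← ContinuousLinearMap.adjoint_inner_right]
  refine mem_constSubspace_iff.1 (hS _ (ext_inner_left ℂ fun f => ?_)) k hk
  rw [← S.isUnitaryRep_koopman.map_apply_neg z f, S.isUnitaryRep_koopman.inner_map_map,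
    ContinuousLinearMap.adjoint_inner_right, ContinuousLinearMap.adjoint_inner_right, ← hAB, ← hA,
    hy]

end FixesOnlyConstants

end Z2Action

end Koopman

section MeanErgodic

theorem tendsto_average_inner_pow {E : Type*} [NormedAddCommGroup E] [InnerProductSpace ℂ E]
    [CompleteSpace E] {A : E →L[ℂ] E} (hA : ‖A‖ ≤ 1) (x y : E) :
    Tendsto (fun N : ℕ => (N : ℂ)⁻¹ * ∑ k ∈ Finset.range N, inner ℂ y ((A ^ k) x)) atTop
      (𝓝 (inner ℂ y ((A.eqLocus (1 : E →L[ℂ] E)).starProjection x))) := by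
  refine (Tendsto.inner (𝕜 := ℂ) (tendsto_const_nhds (x := y))
    (A.tendsto_birkhoffAverage_orthogonalProjection hA x)).congr fun N => ?_
  simp [birkhoffAverage, birkhoffSum, inner_smul_right, inner_sum]

theorem tendsto_average_mul_of_tendsto_average_norm_sq {a b : ℕ → ℂ} {C : ℝ}
    (hb : ∀ k, ‖b k‖ ≤ C)
    (ha : Tendsto (fun N : ℕ => (N : ℝ)⁻¹ * ∑ k ∈ Finset.range N, ‖a k‖ ^ 2) atTop (𝓝 0)) :
    Tendsto (fun N : ℕ => (N : ℂ)⁻¹ * ∑ k ∈ Finset.range N, a k * b k) atTop (𝓝 0) := by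
  have norm_sq_le (N : ℕ) : ‖(N : ℂ)⁻¹ * ∑ k ∈ Finset.range N, a k * b k‖ ^ 2 ≤
      C ^ 2 * ((N : ℝ)⁻¹ * ∑ k ∈ Finset.range N, ‖a k‖ ^ 2) := by
    rcases N.eq_zero_or_pos with rfl | hN
    · simp
    calc ‖(N : ℂ)⁻¹ * ∑ k ∈ Finset.range N, a k * b k‖ ^ 2
        ≤ ((N : ℝ)⁻¹ * ∑ k ∈ Finset.range N, ‖a k‖ * C) ^ 2 := by
          rw [norm_mul, norm_inv, Complex.norm_natCast]
          gcongr
          refine norm_sum_le_of_le _ fun k _ => ?_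
          rw [norm_mul]
          gcongr
          exact hb k
      _ = ((N : ℝ)⁻¹ * C) ^ 2 * (∑ k ∈ Finset.range N, ‖a k‖) ^ 2 := by
          rw [← Finset.sum_mul]; ring
      _ ≤ ((N : ℝ)⁻¹ * C) ^ 2 * (N * ∑ k ∈ Finset.range N, ‖a k‖ ^ 2) := by
          gcongr
          simpa using sq_sum_le_card_mul_sum_sq (s := Finset.range N) (f := fun k => ‖a k‖)
      _ = C ^ 2 * ((N : ℝ)⁻¹ * ∑ k ∈ Finset.range N, ‖a k‖ ^ 2) := by
          field_simp
  have tendsto_norm_sq := squeeze_zero (fun N => by positivity) norm_sq_le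
    (by simpa using ha.const_mul (C ^ 2))
  refine tendsto_zero_iff_norm_tendsto_zero.2 ?_
  simpa only [Real.sqrt_sq (norm_nonneg _), Real.sqrt_zero] using tendsto_norm_sq.sqrt

end MeanErgodic

namespace Z2Action.FixesOnlyConstants

variable {X Y : Type*} [MeasurableSpace X] [MeasurableSpace Y] {μ : Measure X} {ν : Measure Y}
  [IsProbabilityMeasure μ] [IsProbabilityMeasure ν] {S : Z2Action μ} {z : ℤ × ℤ}

theorem starProjection_eq_zero (hS : S.FixesOnlyConstants z) {f : Lp ℂ 2 μ} (hf : f ∈ L2Zero μ) :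
    ((S.koopman z).eqLocus (1 : Lp ℂ 2 μ →L[ℂ] Lp ℂ 2 μ)).starProjection f = 0 := by
  rw [Submodule.starProjection_apply_eq_zero_iff, Submodule.mem_orthogonal']
  exact fun g hg => Submodule.inner_left_of_mem_orthogonal (hS g hg) hf

theorem tendsto_average_norm_inner_sq (hS : (S.prod S).FixesOnlyConstants z) {f : Lp ℂ 2 μ}
    (hf : f ∈ L2Zero μ) (g : Lp ℂ 2 μ) :
    Tendsto (fun N : ℕ => (N : ℝ)⁻¹ *
      ∑ k ∈ Finset.range N, ‖inner ℂ g ((S.koopman z ^ k) f)‖ ^ 2) atTop (𝓝 0) := by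
  have koopman_pow (k : ℕ) : ((S.prod S).koopman z ^ k) (lpTmul f (star f)) =
      lpTmul ((S.koopman z ^ k) f) (star ((S.koopman z ^ k) f)) := by
    induction k with
    | zero => simp
    | succ k ih =>
      simp only [pow_succ', mul_apply_eq_comp, ih, koopman_prod_lpTmul, koopman_star]
  have tendsto_average := tendsto_average_inner_pow ((S.prod S).norm_koopman_le z)
    (lpTmul f (star f)) (lpTmul g (star g))
  rw [hS.starProjection_eq_zero (lpTmul_mem_L2Zero_left hf _), inner_zero_right]
    at tendsto_average
  rw [← Complex.ofReal_zero] at tendsto_average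
  refine tendsto_ofReal_iff.1 (tendsto_average.congr fun N => ?_)
  simp only [koopman_pow, inner_lpTmul, inner_star_star, RCLike.mul_conj]
  push_cast
  rfl

theorem inner_lpTmul_eq_zero (hS : (S.prod S).FixesOnlyConstants z)
    {W : Lp ℂ 2 ν →L[ℂ] Lp ℂ 2 ν} (hW : ‖W‖ ≤ 1) {F : Lp ℂ 2 (μ.prod ν)}
    (hF : opTensor (S.koopman z) W F = F) {f : Lp ℂ 2 μ} (hf : f ∈ L2Zero μ) (g : Lp ℂ 2 ν) :
    inner ℂ (lpTmul f g) F = 0 := by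
  set A := opTensor (S.koopman z) W
  have norm_A : ‖A‖ ≤ 1 := (norm_opTensor_le _ _).trans
    (mul_le_one₀ (S.norm_koopman_le z) (norm_nonneg _) hW)
  have pow_lpTmul (k : ℕ) : (A ^ k) (lpTmul f g) = lpTmul ((S.koopman z ^ k) f) ((W ^ k) g) := by
    induction k with
    | zero => simp
    | succ k ih => simp only [pow_succ', mul_apply_eq_comp, ih, A, opTensor_lpTmul]
  have norm_pow_apply_le (k : ℕ) : ‖(W ^ k) g‖ ≤ ‖g‖ := by
    induction k with
    | zero => simp
    | succ k ih =>
      rw [pow_succ', mul_apply_eq_comp]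
      exact ((W.le_of_opNorm_le hW _).trans_eq (one_mul _)).trans ih
  have projection_eq_zero :
      (A.eqLocus (1 : Lp ℂ 2 (μ.prod ν) →L[ℂ] Lp ℂ 2 (μ.prod ν))).starProjection
        (lpTmul f g) = 0 := by
    refine eq_zero_of_inner_lpTmul fun f' g' => tendsto_nhds_unique
      (tendsto_average_inner_pow norm_A (lpTmul f g) (lpTmul f' g')) ?_
    simp only [pow_lpTmul, inner_lpTmul]
    refine tendsto_average_mul_of_tendsto_average_norm_sq (C := ‖g'‖ * ‖g‖) (fun k => ?_)
      (hS.tendsto_average_norm_inner_sq hf f')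
    refine (norm_inner_le_norm _ _).trans ?_
    gcongr
    exact norm_pow_apply_le k
  exact Submodule.inner_left_of_mem_orthogonal hF
    ((Submodule.starProjection_apply_eq_zero_iff _).1 projection_eq_zero)

theorem mem_constSubspace_of_opTensor_eq (hS : (S.prod S).FixesOnlyConstants z)
    {F : Lp ℂ 2 (μ.prod μ)} (hF : opTensor (S.koopman z) 1 F = opTensor 1 (S.koopman z) F) :
    F ∈ constSubspace (μ.prod μ) := by
  have hU := S.isUnitaryRep_koopman
  have neg_mul_self : S.koopman (-z) * S.koopman z = 1 := by
    rw [← hU.map_add, neg_add_cancel, hU.map_zero]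
  have fixed_skew : opTensor (S.koopman z) (S.koopman (-z)) F = F := by
    have := congrArg (opTensor 1 (S.koopman (-z))) hF
    rwa [← mul_apply_eq_comp, ← mul_apply_eq_comp, opTensor_mul, opTensor_mul, one_mul, mul_one,
      one_mul, neg_mul_self, opTensor_one, one_apply_eq_self] at this
  have star_left : star (opTensor (S.koopman (-z)) (1 : Lp ℂ 2 μ →L[ℂ] Lp ℂ 2 μ)) =
      opTensor (S.koopman z) 1 := by
    rw [star_opTensor, hU.star_eq, neg_neg, star_one]
  have fixed_left : opTensor (S.koopman z) 1 F = F := by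
    refine sub_eq_zero.1 (eq_zero_of_inner_lpTmul fun f g => ?_)
    rw [inner_sub_right, ← star_left, ContinuousLinearMap.star_eq_adjoint,
      ContinuousLinearMap.adjoint_inner_right, opTensor_lpTmul, ← inner_sub_left,
      one_apply_eq_self, ← LinearMap.sub_apply, ← map_sub]
    exact hS.inner_lpTmul_eq_zero (S.norm_koopman_le (-z)) fixed_skew
      (S.koopman_sub_mem_L2Zero (-z) f) g
  have tensor_eq : opTensor (S.koopman z) (S.koopman z) =
      opTensor (S.koopman z) 1 * opTensor 1 (S.koopman z) := by
    rw [opTensor_mul, mul_one, one_mul]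
  refine hS F ?_
  rw [koopman_prod, tensor_eq, mul_apply_eq_comp, ← hF, fixed_left, fixed_left]

end Z2Action.FixesOnlyConstants

/-! ### Symmetric and antisymmetric functions -/

section Swap

variable {X : Type*} [MeasurableSpace X] {μ : Measure X}

variable (μ) in
/-- The operator `g(x, y) ↦ g(y, x)`. -/
def swapOp [SFinite μ] : Lp ℂ 2 (μ.prod μ) →L[ℂ] Lp ℂ 2 (μ.prod μ) :=
  (Lp.compMeasurePreservingₗᵢ ℂ (Prod.swap : X × X → X × X)
      (Measure.measurePreserving_swap (μ := μ) (ν := μ))).toContinuousLinearMap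

theorem inner_swapOp_swapOp [SFinite μ] (f g : Lp ℂ 2 (μ.prod μ)) :
    inner ℂ (swapOp μ f) (swapOp μ g) = inner ℂ f g :=
  LinearIsometry.inner_map_map _ f g

theorem swapOp_lpTmul [SFinite μ] (f g : Lp ℂ 2 μ) : swapOp μ (lpTmul f g) = lpTmul g f := by
  refine Lp.ext ?_
  have swap_preserving := Measure.measurePreserving_swap (μ := μ) (ν := μ)
  filter_upwards [Lp.coeFn_compMeasurePreserving (lpTmul f g) swap_preserving, coeFn_lpTmul g f,
    swap_preserving.quasiMeasurePreserving.ae (coeFn_lpTmul f g)] with p h_comp h_tmul h_tmul_swap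
  refine h_comp.trans ?_
  rw [h_tmul, Function.comp_apply, h_tmul_swap]
  exact mul_comm _ _

/-- The operator `V ⊗ 1 - 1 ⊗ V`, which exchanges symmetric and antisymmetric functions. -/
def tensorDiff [IsFiniteMeasure μ] (V : Lp ℂ 2 μ →L[ℂ] Lp ℂ 2 μ) :
    Lp ℂ 2 (μ.prod μ) →L[ℂ] Lp ℂ 2 (μ.prod μ) :=
  opTensor V 1 - opTensor 1 V

section Finite

variable [IsFiniteMeasure μ]

theorem swapOp_swapOp (g : Lp ℂ 2 (μ.prod μ)) : swapOp μ (swapOp μ g) = g := by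
  have mul_self : swapOp μ * swapOp μ = 1 := ext_lpTmul fun f g => by
    rw [mul_apply_eq_comp, swapOp_lpTmul, swapOp_lpTmul, one_apply_eq_self]
  exact DFunLike.congr_fun mul_self g

theorem swapOp_tensorDiff (V : Lp ℂ 2 μ →L[ℂ] Lp ℂ 2 μ) (g : Lp ℂ 2 (μ.prod μ)) :
    swapOp μ (tensorDiff V g) = -tensorDiff V (swapOp μ g) := by
  have mul_eq : swapOp μ * tensorDiff V = -(tensorDiff V * swapOp μ) := ext_lpTmul fun f g => by
    simp only [tensorDiff, mul_apply_eq_comp, neg_apply, sub_apply, map_sub, opTensor_lpTmul,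
      swapOp_lpTmul, one_apply_eq_self, neg_sub]
  exact DFunLike.congr_fun mul_eq g

theorem star_tensorDiff (V : Lp ℂ 2 μ →L[ℂ] Lp ℂ 2 μ) :
    star (tensorDiff V) = tensorDiff (star V) := by
  simp only [tensorDiff, star_sub, star_opTensor, star_one]

theorem inner_tensorDiff_left (V : Lp ℂ 2 μ →L[ℂ] Lp ℂ 2 μ) (f g : Lp ℂ 2 (μ.prod μ)) :
    inner ℂ (tensorDiff V f) g = inner ℂ f (tensorDiff (star V) g) := by
  rw [← star_tensorDiff, ContinuousLinearMap.star_eq_adjoint,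
    ContinuousLinearMap.adjoint_inner_right]

end Finite

variable [IsProbabilityMeasure μ]

theorem tensorDiff_lpOne {V : Lp ℂ 2 μ →L[ℂ] Lp ℂ 2 μ} (hV : V (lpOne μ) = lpOne μ) :
    tensorDiff V (lpOne (μ.prod μ)) = 0 := by
  rw [← lpTmul_lpOne, tensorDiff, sub_apply, opTensor_lpTmul, opTensor_lpTmul, hV,
    one_apply_eq_self, sub_self]

theorem mem_symmSubspace {g : Lp ℂ 2 (μ.prod μ)} : g ∈ symmSubspace μ ↔ swapOp μ g = g := Iff.rfl

theorem isClosed_symmSubspace : IsClosed (symmSubspace μ : Set (Lp ℂ 2 (μ.prod μ))) :=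
  isClosed_eq (swapOp μ).continuous continuous_id

theorem constSubspace_le_symmSubspace : constSubspace (μ.prod μ) ≤ symmSubspace μ := by
  have swapOp_lpOne : swapOp μ (lpOne (μ.prod μ)) = lpOne (μ.prod μ) := by
    rw [← lpTmul_lpOne, swapOp_lpTmul]
  exact (Submodule.span_singleton_le_iff_mem ..).2 swapOp_lpOne

theorem inner_eq_zero_of_swapOp_eq {f g : Lp ℂ 2 (μ.prod μ)} (hf : swapOp μ f = f)
    (hg : swapOp μ g = -g) : inner ℂ f g = 0 := by
  have inner_swap := inner_swapOp_swapOp f g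
  rw [hf, hg, inner_neg_right] at inner_swap
  exact self_eq_neg.1 inner_swap.symm

variable (μ) in
/-- The symmetric functions orthogonal to the constants, on which the symmetric square of an
action is considered. -/
abbrev symmL2Zero : Submodule ℂ (Lp ℂ 2 (μ.prod μ)) := symmSubspace μ ⊓ L2Zero (μ.prod μ)

instance : CompleteSpace (symmSubspace μ) := isClosed_symmSubspace.completeSpace_coe

instance : CompleteSpace (symmL2Zero μ) :=
  (isClosed_symmSubspace.inter isClosed_L2Zero).completeSpace_coe

theorem symmL2Zero_sup_orthogonal_symmSubspace :
    symmL2Zero μ ⊔ (symmSubspace μ)ᗮ = L2Zero (μ.prod μ) := by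
  have sup_eq := Submodule.sup_orthogonal_inf_of_hasOrthogonalProjection
    (Submodule.orthogonal_le (constSubspace_le_symmSubspace (μ := μ)))
  rwa [Submodule.orthogonal_orthogonal, sup_comm] at sup_eq

namespace Z2Action

variable {R : Z2Action μ} {z : ℤ × ℤ}

theorem FixesOnlyConstants.neg (hR : R.FixesOnlyConstants z) : R.FixesOnlyConstants (-z) :=
  fun f hf => hR f <| by
    conv_lhs => rw [← hf, R.isUnitaryRep_koopman.map_apply_neg]

theorem tensorDiff_koopman_mem_L2Zero (R : Z2Action μ) (z : ℤ × ℤ) (g : Lp ℂ 2 (μ.prod μ)) :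
    tensorDiff (R.koopman z) g ∈ L2Zero (μ.prod μ) := by
  rw [mem_L2Zero_iff, ← inner_conj_symm, inner_tensorDiff_left, R.isUnitaryRep_koopman.star_eq,
    tensorDiff_lpOne (R.koopman_lpOne _), inner_zero_right, _root_.map_zero]

theorem FixesOnlyConstants.mem_constSubspace_of_tensorDiff
    (hR : (R.prod R).FixesOnlyConstants z) {g : Lp ℂ 2 (μ.prod μ)}
    (hg : tensorDiff (R.koopman z) g = 0) : g ∈ constSubspace (μ.prod μ) :=
  hR.mem_constSubspace_of_opTensor_eq (sub_eq_zero.1 hg)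

theorem FixesOnlyConstants.swapOp_eq_of_forall_inner_tensorDiff
    (hR : (R.prod R).FixesOnlyConstants z) {g : Lp ℂ 2 (μ.prod μ)}
    (hg : ∀ s ∈ symmL2Zero μ, inner ℂ s (tensorDiff (R.koopman z) g) = 0) : swapOp μ g = g := by
  set D := tensorDiff (R.koopman z)
  set w := g - swapOp μ g with hw
  have swap_w : swapOp μ w = -w := by rw [hw, map_sub, swapOp_swapOp, neg_sub]
  have symm_Dw : D w ∈ symmL2Zero μ :=
    ⟨mem_symmSubspace.2 (by rw [swapOp_tensorDiff, swap_w, map_neg, neg_neg]),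
      R.tensorDiff_koopman_mem_L2Zero z w⟩
  have inner_swap (s) (hs : s ∈ symmL2Zero μ) : inner ℂ s (D (swapOp μ g)) = 0 := by
    rw [← neg_eq_zero, ← inner_neg_right, ← swapOp_tensorDiff, ← mem_symmSubspace.1 hs.1,
      inner_swapOp_swapOp, hg s hs]
  have inner_Dw (s) (hs : s ∈ symmL2Zero μ) : inner ℂ s (D w) = 0 := by
    rw [hw, map_sub, inner_sub_right, hg s hs, inner_swap s hs, sub_zero]
  have Dw_eq_zero : D w = 0 := inner_self_eq_zero.1 (inner_Dw _ symm_Dw)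
  have w_const := hR.mem_constSubspace_of_tensorDiff Dw_eq_zero
  have w_eq_zero : w = 0 := (inner_self_eq_zero (𝕜 := ℂ)).1
    (inner_eq_zero_of_swapOp_eq (constSubspace_le_symmSubspace w_const) swap_w)
  exact (sub_eq_zero.1 w_eq_zero).symm

theorem FixesOnlyConstants.ker_starProjection_mul_tensorDiff
    (hR : (R.prod R).FixesOnlyConstants z) :
    ((symmL2Zero μ).starProjection * tensorDiff (R.koopman z)).ker = symmSubspace μ := by
  refine Submodule.ext fun g => ?_
  rw [LinearMap.mem_ker, ContinuousLinearMap.coe_coe, mul_apply_eq_comp,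
    Submodule.starProjection_apply_eq_zero_iff, Submodule.mem_orthogonal]
  refine ⟨hR.swapOp_eq_of_forall_inner_tensorDiff, fun hg s hs => ?_⟩
  refine inner_eq_zero_of_swapOp_eq hs.1 ?_
  rw [swapOp_tensorDiff, mem_symmSubspace.1 hg]

theorem FixesOnlyConstants.ker_tensorDiff_mul_starProjection
    (hR : (R.prod R).FixesOnlyConstants z) :
    (tensorDiff (R.koopman z) * (symmL2Zero μ).starProjection).ker = (symmL2Zero μ)ᗮ := by
  refine Submodule.ext fun g => ?_
  rw [LinearMap.mem_ker, ContinuousLinearMap.coe_coe, mul_apply_eq_comp,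
    ← Submodule.starProjection_apply_eq_zero_iff]
  refine ⟨fun hg => ?_, fun hg => by rw [hg, _root_.map_zero]⟩
  exact eq_zero_of_mem_constSubspace_of_mem_L2Zero (hR.mem_constSubspace_of_tensorDiff hg)
    (Submodule.starProjection_apply_mem (symmL2Zero μ) g).2

theorem commute_tensorDiff_koopman (R : Z2Action μ) (z z' : ℤ × ℤ) :
    Commute (tensorDiff (R.koopman z)) ((R.prod R).koopman z') := by
  have koopman_comm := (R.isUnitaryRep_koopman.commute z z').eq
  rw [koopman_prod]
  refine Commute.sub_left ?_ ?_ <;>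
    rw [Commute, SemiconjBy, opTensor_mul, opTensor_mul, koopman_comm, mul_one, one_mul]

theorem koopman_prod_mem_symmL2Zero (R : Z2Action μ) (z : ℤ × ℤ) {g : Lp ℂ 2 (μ.prod μ)}
    (hg : g ∈ symmL2Zero μ) : (R.prod R).koopman z g ∈ symmL2Zero μ := by
  have swap_comm : swapOp μ * (R.prod R).koopman z = (R.prod R).koopman z * swapOp μ :=
    ext_lpTmul fun f g => by
      simp only [mul_apply_eq_comp, koopman_prod_lpTmul, swapOp_lpTmul]
  refine ⟨mem_symmSubspace.2 ?_, (R.prod R).koopman_mem_L2Zero z hg.2⟩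
  rw [← mul_apply_eq_comp, swap_comm, mul_apply_eq_comp, mem_symmSubspace.1 hg.1]

-- The polar part of `V ⊗ 1 - 1 ⊗ V`, restricted to symmetric functions, is the isomorphism.
theorem restrictionsIsomorphic_symmL2Zero_orthogonal (hR : (R.prod R).FixesOnlyConstants z) :
    RestrictionsIsomorphic (R.prod R).koopman (symmL2Zero μ) (symmSubspace μ)ᗮ := by
  have hU := (R.prod R).isUnitaryRep_koopman
  set A := tensorDiff (R.koopman z) * (symmL2Zero μ).starProjection with hA
  have comm_A (z') : Commute A ((R.prod R).koopman z') :=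
    (R.commute_tensorDiff_koopman z z').mul_left
      (hU.commute_starProjection (fun z _ hg => R.koopman_prod_mem_symmL2Zero z hg) z')
  have star_A : star A = (symmL2Zero μ).starProjection * tensorDiff (R.koopman (-z)) := by
    rw [hA, star_mul, star_tensorDiff, R.isUnitaryRep_koopman.star_eq,
      (isSelfAdjoint_starProjection _).star_eq]
  have iso := hU.restrictionsIsomorphic_orthogonal_ker comm_A
  rwa [star_A, hA, hR.neg.ker_starProjection_mul_tensorDiff, hR.ker_tensorDiff_mul_starProjection,
    Submodule.orthogonal_orthogonal] at iso

theorem SymmSquareHasSimpleSpectrum.hasHomogeneousSpectrum_prod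
    (hsimple : R.SymmSquareHasSimpleSpectrum) (hR : (R.prod R).FixesOnlyConstants z) :
    HasHomogeneousSpectrum (R.prod R).koopman (L2Zero (μ.prod μ)) 2 := by
  have hU := (R.prod R).isUnitaryRep_koopman
  obtain ⟨h, span_h⟩ : IsCyclicSubspace (R.prod R).koopman (symmL2Zero μ) := hsimple
  have iso := restrictionsIsomorphic_symmL2Zero_orthogonal hR
  rw [← span_h] at iso
  obtain ⟨h', span_h', inner_h'⟩ := hU.exists_generator_of_restrictionsIsomorphic iso
  have h_symm (z) : (R.prod R).koopman z h ∈ symmSubspace μ :=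
    (span_h.le (apply_mem_cyclicSpan z h)).1
  have h'_orthogonal (z) : (R.prod R).koopman z h' ∈ (symmSubspace μ)ᗮ :=
    span_h'.le (apply_mem_cyclicSpan z h')
  have h_mem : h ∈ symmSubspace μ := (span_h.le (hU.self_mem_cyclicSpan h)).1
  have h'_mem : h' ∈ (symmSubspace μ)ᗮ := span_h'.le (hU.self_mem_cyclicSpan h')
  have correlation : HasDiagonalCorrelation (R.prod R).koopman
      (fun z => inner ℂ ((R.prod R).koopman z h) h) (fun b : Bool => cond b h h') :=
    { inner_self := fun z => Bool.forall_bool.2 ⟨inner_h' z, rfl⟩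
      inner_of_ne := fun z => by
        rintro (_ | _) (_ | _) hij
        · exact absurd rfl hij
        · exact Submodule.inner_left_of_mem_orthogonal h_mem (h'_orthogonal z)
        · exact Submodule.inner_right_of_mem_orthogonal (h_symm z) h'_mem
        · exact absurd rfl hij }
  have cyclicSum_eq :
      cyclicSum (R.prod R).koopman (fun b : Bool => cond b h h') = L2Zero (μ.prod μ) := by
    rw [cyclicSum, iSup_bool_eq, cond_true, cond_false, span_h, span_h',
      symmL2Zero_sup_orthogonal_symmSubspace]
    exact isClosed_L2Zero.submodule_topologicalClosure_eq
  rw [← cyclicSum_eq]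
  exact hU.hasHomogeneousSpectrum_cyclicSum correlation

end Z2Action

end Swap

/-! ### Products of actions whose commutant splits -/

section Product

variable {X Y : Type*} [MeasurableSpace X] [MeasurableSpace Y] {μ : Measure X} {ν : Measure Y}

theorem lpTmul_mem_of_mem_cyclicSum [SFinite μ] [SFinite ν]
    {U : ℤ × ℤ → Lp ℂ 2 μ →L[ℂ] Lp ℂ 2 μ} {V : ℤ × ℤ → Lp ℂ 2 ν →L[ℂ] Lp ℂ 2 ν}
    {ι κ : Type*} {a : ι → Lp ℂ 2 μ} {b : κ → Lp ℂ 2 ν} {K : Submodule ℂ (Lp ℂ 2 (μ.prod ν))}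
    (hK : IsClosed (K : Set (Lp ℂ 2 (μ.prod ν))))
    (hab : ∀ i j z z', lpTmul (U z (a i)) (V z' (b j)) ∈ K) {f : Lp ℂ 2 μ} {g : Lp ℂ 2 ν}
    (hf : f ∈ cyclicSum U a) (hg : g ∈ cyclicSum V b) : lpTmul f g ∈ K := by
  have mem_right (j z') : lpTmul f (V z' (b j)) ∈ K := by
    have le_comap : cyclicSum U a ≤ K.comap (lpTmulL.flip (V z' (b j))).toLinearMap :=
      cyclicSum_le (hK.preimage (lpTmulL.flip (V z' (b j))).continuous) fun i z => hab i j z z'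
    exact le_comap hf
  have le_comap : cyclicSum V b ≤ K.comap (lpTmulL f).toLinearMap :=
    cyclicSum_le (hK.preimage (lpTmulL f).continuous) mem_right
  exact le_comap hg

variable [IsProbabilityMeasure μ] [IsProbabilityMeasure ν]

theorem exists_eq_add_smul_lpOne (f : Lp ℂ 2 μ) : ∃ f₀ ∈ L2Zero μ, ∃ c : ℂ, f = f₀ + c • lpOne μ :=
  ⟨f - constProj μ f, Submodule.sub_starProjection_mem_orthogonal f, inner ℂ (lpOne μ) f, by
    rw [← constProj_apply, sub_add_cancel]⟩

theorem eq_L2Zero_prod_of_lpTmul_mem {K : Submodule ℂ (Lp ℂ 2 (μ.prod ν))}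
    (hKc : IsClosed (K : Set (Lp ℂ 2 (μ.prod ν)))) (hK : K ≤ L2Zero (μ.prod ν))
    (mem_left : ∀ f ∈ L2Zero μ, lpTmul f (lpOne ν) ∈ K)
    (mem_right : ∀ g ∈ L2Zero ν, lpTmul (lpOne μ) g ∈ K)
    (mem_tmul : ∀ f ∈ L2Zero μ, ∀ g ∈ L2Zero ν, lpTmul f g ∈ K) : K = L2Zero (μ.prod ν) := by
  have : CompleteSpace K := hKc.completeSpace_coe
  have orthogonal_inf : Kᗮ ⊓ L2Zero (μ.prod ν) = ⊥ := by
    refine (Submodule.eq_bot_iff _).2 fun w hw => eq_zero_of_inner_lpTmul fun f g => ?_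
    obtain ⟨f₀, hf₀, c, rfl⟩ := exists_eq_add_smul_lpOne f
    obtain ⟨g₀, hg₀, d, rfl⟩ := exists_eq_add_smul_lpOne g
    have inner_one : inner ℂ (lpTmul (lpOne μ) (lpOne ν)) w = 0 := by
      rw [lpTmul_lpOne, mem_L2Zero_iff.1 hw.2]
    simp only [map_add, map_smul, LinearMap.add_apply, LinearMap.smul_apply, inner_add_left,
      inner_smul_left, hw.1 _ (mem_tmul f₀ hf₀ g₀ hg₀), hw.1 _ (mem_left f₀ hf₀),
      hw.1 _ (mem_right g₀ hg₀), inner_one, mul_zero, add_zero]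
  rw [← Submodule.sup_orthogonal_inf_of_hasOrthogonalProjection hK, orthogonal_inf, sup_bot_eq]

/-- The function `f(x) + g(y)`. -/
def lpTadd (f : Lp ℂ 2 μ) (g : Lp ℂ 2 ν) : Lp ℂ 2 (μ.prod ν) :=
  lpTmul f (lpOne ν) + lpTmul (lpOne μ) g

theorem inner_lpTadd {f f' : Lp ℂ 2 μ} (hf : f ∈ L2Zero μ) (hf' : f' ∈ L2Zero μ) (g g' : Lp ℂ 2 ν) :
    inner ℂ (lpTadd f g) (lpTadd f' g') = inner ℂ f f' + inner ℂ g g' := by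
  have inner_one : inner ℂ f (lpOne μ) = 0 := by
    rw [← inner_conj_symm, mem_L2Zero_iff.1 hf, map_zero]
  simp only [lpTadd, inner_add_left, inner_add_right, inner_lpTmul, inner_lpOne_self, inner_one,
    mem_L2Zero_iff.1 hf', zero_mul, mul_one, one_mul, add_zero, zero_add]

theorem lpTadd_mem_L2Zero {f : Lp ℂ 2 μ} {g : Lp ℂ 2 ν} (hf : f ∈ L2Zero μ) (hg : g ∈ L2Zero ν) :
    lpTadd f g ∈ L2Zero (μ.prod ν) :=
  add_mem (lpTmul_mem_L2Zero_left hf _) (lpTmul_mem_L2Zero_right _ hg)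

namespace Z2Action

variable {S : Z2Action μ} {T : Z2Action ν} {e : ℤ × ℤ}

theorem koopman_prod_lpTadd (S : Z2Action μ) (T : Z2Action ν) (z : ℤ × ℤ) (f : Lp ℂ 2 μ)
    (g : Lp ℂ 2 ν) :
    (S.prod T).koopman z (lpTadd f g) = lpTadd (S.koopman z f) (T.koopman z g) := by
  rw [lpTadd, _root_.map_add, koopman_prod_lpTmul, koopman_prod_lpTmul, koopman_lpOne,
    koopman_lpOne, lpTadd]

/-- Every bounded operator commuting with `Ŝ^z ⊗ T̂^z` for all `z` also commutes with `1 ⊗ T̂^z`,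
and hence with `Ŝ^z ⊗ 1`. -/
def CommutantSplits (S : Z2Action μ) (T : Z2Action ν) : Prop :=
  ∀ J : Lp ℂ 2 (μ.prod ν) →L[ℂ] Lp ℂ 2 (μ.prod ν), (∀ z, Commute J ((S.prod T).koopman z)) →
    ∀ z, Commute J (opTensor 1 (T.koopman z))

namespace CommutantSplits

variable {J : Lp ℂ 2 (μ.prod ν) →L[ℂ] Lp ℂ 2 (μ.prod ν)}

theorem commute_left (h : CommutantSplits S T) (hJ : ∀ z, Commute J ((S.prod T).koopman z))
    (z : ℤ × ℤ) : Commute J (opTensor (S.koopman z) 1) := by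
  have commute_mul := (hJ z).mul_right (h J hJ (-z))
  rwa [koopman_prod, opTensor_mul, mul_one, ← T.isUnitaryRep_koopman.map_add, add_neg_cancel,
    T.isUnitaryRep_koopman.map_zero] at commute_mul

theorem map_lpTmul_lpOne_fixed (h : CommutantSplits S T)
    (hJ : ∀ z, Commute J ((S.prod T).koopman z)) (z : ℤ × ℤ) (f : Lp ℂ 2 μ) :
    opTensor 1 (T.koopman z) (J (lpTmul f (lpOne ν))) = J (lpTmul f (lpOne ν)) := by
  rw [← mul_apply_eq_comp, ← (h J hJ z).eq, mul_apply_eq_comp, opTensor_lpTmul, koopman_lpOne,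
    one_apply_eq_self]

theorem map_lpOne_lpTmul_fixed (h : CommutantSplits S T)
    (hJ : ∀ z, Commute J ((S.prod T).koopman z)) (z : ℤ × ℤ) (g : Lp ℂ 2 ν) :
    opTensor (S.koopman z) 1 (J (lpTmul (lpOne μ) g)) = J (lpTmul (lpOne μ) g) := by
  rw [← mul_apply_eq_comp, ← (h.commute_left hJ z).eq, mul_apply_eq_comp, opTensor_lpTmul,
    koopman_lpOne, one_apply_eq_self]

theorem inner_lpTmul_map_lpTadd (h : CommutantSplits S T)
    (hfix : (S.prod T).FixesOnlyConstants e) (hJ : ∀ z, Commute J ((S.prod T).koopman z))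
    {f : Lp ℂ 2 μ} {g : Lp ℂ 2 ν} (hf : f ∈ L2Zero μ) (hg : g ∈ L2Zero ν) (f' : Lp ℂ 2 μ)
    (g' : Lp ℂ 2 ν) : inner ℂ (lpTmul f g) (J (lpTadd f' g')) = 0 := by
  have inner_left : inner ℂ (lpTmul f g) (J (lpTmul f' (lpOne ν))) = 0 :=
    hfix.snd.inner_map_eq_zero (B := lpTmulL f)
      (inner_opTensor_opTensor (by rw [star_one, one_mul])
        (T.isUnitaryRep_koopman.star_mul_self e))
      (opTensor_lpTmul 1 (T.koopman e) f) (h.map_lpTmul_lpOne_fixed hJ e f') hg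
  have inner_right : inner ℂ (lpTmul f g) (J (lpTmul (lpOne μ) g')) = 0 :=
    hfix.fst.inner_map_eq_zero (B := lpTmulL.flip g)
      (inner_opTensor_opTensor (S.isUnitaryRep_koopman.star_mul_self e)
        (by rw [star_one, one_mul]))
      (fun k => opTensor_lpTmul (S.koopman e) 1 k g) (h.map_lpOne_lpTmul_fixed hJ e g') hf
  rw [lpTadd, _root_.map_add, inner_add_right, inner_left, inner_right, add_zero]

theorem lpTmul_koopman_mem (h : CommutantSplits S T) {K : Submodule ℂ (Lp ℂ 2 (μ.prod ν))}
    [K.HasOrthogonalProjection] (hK : ∀ z, ∀ x ∈ K, (S.prod T).koopman z x ∈ K)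
    {f : Lp ℂ 2 μ} {g : Lp ℂ 2 ν} (hfg : lpTmul f g ∈ K) (z z' : ℤ × ℤ) :
    lpTmul (S.koopman z f) (T.koopman z' g) ∈ K := by
  have commute_proj := (S.prod T).isUnitaryRep_koopman.commute_starProjection hK
  have mem_right : lpTmul f (T.koopman z' g) ∈ K := by
    simpa only [opTensor_lpTmul, one_apply_eq_self] using
      map_mem_of_commute_starProjection (h _ commute_proj z') hfg
  simpa only [opTensor_lpTmul, one_apply_eq_self] using
    map_mem_of_commute_starProjection (h.commute_left commute_proj z) mem_right

theorem lpTmul_lpOne_mem (h : CommutantSplits S T) (hfix : (S.prod T).FixesOnlyConstants e)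
    {K : Submodule ℂ (Lp ℂ 2 (μ.prod ν))} [K.HasOrthogonalProjection] (hK₀ : K ≤ L2Zero (μ.prod ν))
    (hK : ∀ z, ∀ x ∈ K, (S.prod T).koopman z x ∈ K) {f : Lp ℂ 2 μ} {g : Lp ℂ 2 ν}
    (hf : f ∈ L2Zero μ) (hfg : lpTadd f g ∈ K) : lpTmul f (lpOne ν) ∈ K := by
  have commute_proj := (S.prod T).isUnitaryRep_koopman.commute_starProjection hK
  set d := K.starProjection (lpTmul f (lpOne ν)) - lpTmul f (lpOne ν) with hd
  have d_eq : d = lpTmul (lpOne μ) g - K.starProjection (lpTmul (lpOne μ) g) := by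
    have proj_lpTadd := Submodule.starProjection_eq_self_iff.2 hfg
    rw [lpTadd, _root_.map_add] at proj_lpTadd
    rw [hd, sub_eq_sub_iff_add_eq_add, proj_lpTadd, add_comm]
  have fixed_right : opTensor 1 (T.koopman e) d = d := by
    rw [hd, _root_.map_sub, h.map_lpTmul_lpOne_fixed commute_proj, opTensor_lpTmul, koopman_lpOne,
      one_apply_eq_self]
  have fixed_left : opTensor (S.koopman e) 1 d = d := by
    rw [d_eq, _root_.map_sub, h.map_lpOne_lpTmul_fixed commute_proj, opTensor_lpTmul,
      koopman_lpOne, one_apply_eq_self]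
  have fixed : (S.prod T).koopman e d = d := by
    rw [koopman_prod, ← mul_one (S.koopman e), ← one_mul (T.koopman e), ← opTensor_mul,
      mul_apply_eq_comp, fixed_right, fixed_left]
  have mem_L2Zero : d ∈ L2Zero (μ.prod ν) :=
    sub_mem (hK₀ (Submodule.starProjection_apply_mem K _)) (lpTmul_mem_L2Zero_left hf _)
  exact Submodule.starProjection_eq_self_iff.1 (sub_eq_zero.1 (hfix.eq_zero fixed mem_L2Zero))

end CommutantSplits

section Generators

variable {ι : Type*} {a : ι → Lp ℂ 2 μ} {b : ι → Lp ℂ 2 ν}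

theorem cyclicSum_lpTadd_le_L2Zero (ha : cyclicSum S.koopman a = L2Zero μ)
    (hb : cyclicSum T.koopman b = L2Zero ν) :
    cyclicSum (S.prod T).koopman (fun i => lpTadd (a i) (b i)) ≤ L2Zero (μ.prod ν) :=
  cyclicSum_le isClosed_L2Zero fun i _ => koopman_mem_L2Zero _ _ <|
    lpTadd_mem_L2Zero (ha ▸ S.isUnitaryRep_koopman.mem_cyclicSum i)
      (hb ▸ T.isUnitaryRep_koopman.mem_cyclicSum i)

theorem cyclicSum_lpTmul_le_L2Zero (ha : cyclicSum S.koopman a = L2Zero μ) :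
    cyclicSum (S.prod T).koopman (fun p : ι × ι => lpTmul (a p.1) (b p.2)) ≤
      L2Zero (μ.prod ν) :=
  cyclicSum_le isClosed_L2Zero fun p _ => koopman_mem_L2Zero _ _ <|
    lpTmul_mem_L2Zero_left (ha ▸ S.isUnitaryRep_koopman.mem_cyclicSum p.1) _

theorem lpTmul_lpOne_mem_cyclicSum_lpTadd (hsplit : CommutantSplits S T)
    (hfix : (S.prod T).FixesOnlyConstants e) (ha : cyclicSum S.koopman a = L2Zero μ)
    (hb : cyclicSum T.koopman b = L2Zero ν) {f : Lp ℂ 2 μ} (hf : f ∈ L2Zero μ) :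
    lpTmul f (lpOne ν) ∈ cyclicSum (S.prod T).koopman (fun i => lpTadd (a i) (b i)) := by
  set K := cyclicSum (S.prod T).koopman (fun i => lpTadd (a i) (b i))
  have : CompleteSpace K := isClosed_cyclicSum.completeSpace_coe
  have unitary := (S.prod T).isUnitaryRep_koopman
  have generator_mem (i) : lpTmul (a i) (lpOne ν) ∈ K :=
    hsplit.lpTmul_lpOne_mem hfix (cyclicSum_lpTadd_le_L2Zero ha hb)
      (fun z _ => unitary.map_mem_cyclicSum z) (ha ▸ S.isUnitaryRep_koopman.mem_cyclicSum i)
      (unitary.mem_cyclicSum i)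
  refine lpTmul_mem_of_mem_cyclicSum (a := a) (b := fun _ : Unit => lpOne ν) isClosed_cyclicSum
    (fun i _ z z' => ?_) (ha ▸ hf) (T.isUnitaryRep_koopman.mem_cyclicSum ())
  exact hsplit.lpTmul_koopman_mem (fun z _ => unitary.map_mem_cyclicSum z) (generator_mem i) z z'

theorem lpOne_lpTmul_mem_cyclicSum_lpTadd (hsplit : CommutantSplits S T)
    (hfix : (S.prod T).FixesOnlyConstants e) (ha : cyclicSum S.koopman a = L2Zero μ)
    (hb : cyclicSum T.koopman b = L2Zero ν) {g : Lp ℂ 2 ν} (hg : g ∈ L2Zero ν) :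
    lpTmul (lpOne μ) g ∈ cyclicSum (S.prod T).koopman (fun i => lpTadd (a i) (b i)) := by
  set K := cyclicSum (S.prod T).koopman (fun i => lpTadd (a i) (b i))
  have : CompleteSpace K := isClosed_cyclicSum.completeSpace_coe
  have unitary := (S.prod T).isUnitaryRep_koopman
  have generator_mem (i) : lpTmul (lpOne μ) (b i) ∈ K :=
    (add_mem_cancel_left (lpTmul_lpOne_mem_cyclicSum_lpTadd hsplit hfix ha hb
      (ha ▸ S.isUnitaryRep_koopman.mem_cyclicSum i))).1 (unitary.mem_cyclicSum i)
  refine lpTmul_mem_of_mem_cyclicSum (a := fun _ : Unit => lpOne μ) (b := b) isClosed_cyclicSum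
    (fun _ i z z' => ?_) (S.isUnitaryRep_koopman.mem_cyclicSum ()) (hb ▸ hg)
  exact hsplit.lpTmul_koopman_mem (fun z _ => unitary.map_mem_cyclicSum z) (generator_mem i) z z'

theorem lpTmul_mem_cyclicSum_lpTmul (hsplit : CommutantSplits S T)
    {f : Lp ℂ 2 μ} {g : Lp ℂ 2 ν} (hf : f ∈ cyclicSum S.koopman a)
    (hg : g ∈ cyclicSum T.koopman b) :
    lpTmul f g ∈ cyclicSum (S.prod T).koopman (fun p : ι × ι => lpTmul (a p.1) (b p.2)) := by
  set K := cyclicSum (S.prod T).koopman (fun p : ι × ι => lpTmul (a p.1) (b p.2))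
  have : CompleteSpace K := isClosed_cyclicSum.completeSpace_coe
  have unitary := (S.prod T).isUnitaryRep_koopman
  exact lpTmul_mem_of_mem_cyclicSum isClosed_cyclicSum (fun i j z z' =>
    hsplit.lpTmul_koopman_mem (fun z _ => unitary.map_mem_cyclicSum z)
      (unitary.mem_cyclicSum (i, j)) z z') hf hg

theorem cyclicSum_lpTadd_sup_cyclicSum_lpTmul (hsplit : CommutantSplits S T)
    (hfix : (S.prod T).FixesOnlyConstants e) (ha : cyclicSum S.koopman a = L2Zero μ)
    (hb : cyclicSum T.koopman b = L2Zero ν) :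
    (cyclicSum (S.prod T).koopman (fun i => lpTadd (a i) (b i)) ⊔
      cyclicSum (S.prod T).koopman (fun p : ι × ι => lpTmul (a p.1) (b p.2))).topologicalClosure =
      L2Zero (μ.prod ν) := by
  refine eq_L2Zero_prod_of_lpTmul_mem (Submodule.isClosed_topologicalClosure _)
    (Submodule.topologicalClosure_minimal _ (sup_le (cyclicSum_lpTadd_le_L2Zero ha hb)
      (cyclicSum_lpTmul_le_L2Zero ha)) isClosed_L2Zero) (fun f hf => ?_) (fun g hg => ?_)
    fun f hf g hg => ?_ <;> refine Submodule.le_topologicalClosure _ ?_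
  · exact Submodule.mem_sup_left (lpTmul_lpOne_mem_cyclicSum_lpTadd hsplit hfix ha hb hf)
  · exact Submodule.mem_sup_left (lpOne_lpTmul_mem_cyclicSum_lpTadd hsplit hfix ha hb hg)
  · exact Submodule.mem_sup_right (lpTmul_mem_cyclicSum_lpTmul hsplit (ha ▸ hf) (hb ▸ hg))

theorem hasDiagonalCorrelation_lpTadd {φ ψ : ℤ × ℤ → ℂ}
    (ha : HasDiagonalCorrelation S.koopman φ a) (hb : HasDiagonalCorrelation T.koopman ψ b)
    (ha₀ : ∀ i, a i ∈ L2Zero μ) :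
    HasDiagonalCorrelation (S.prod T).koopman (φ + ψ) (fun i => lpTadd (a i) (b i)) where
  inner_self z i := by
    rw [koopman_prod_lpTadd, inner_lpTadd (koopman_mem_L2Zero S z (ha₀ i)) (ha₀ i), ha.inner_self,
      hb.inner_self, Pi.add_apply]
  inner_of_ne z i j hij := by
    beta_reduce
    rw [koopman_prod_lpTadd, inner_lpTadd (koopman_mem_L2Zero S z (ha₀ i)) (ha₀ j),
      ha.inner_of_ne z hij, hb.inner_of_ne z hij, add_zero]

theorem hasDiagonalCorrelation_lpTmul {φ ψ : ℤ × ℤ → ℂ}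
    (ha : HasDiagonalCorrelation S.koopman φ a) (hb : HasDiagonalCorrelation T.koopman ψ b) :
    HasDiagonalCorrelation (S.prod T).koopman (φ * ψ)
      (fun p : ι × ι => lpTmul (a p.1) (b p.2)) where
  inner_self z p := by
    rw [koopman_prod_lpTmul, inner_lpTmul, ha.inner_self, hb.inner_self, Pi.mul_apply]
  inner_of_ne z p q hpq := by
    beta_reduce
    rw [koopman_prod_lpTmul, inner_lpTmul]
    obtain h_fst | h_snd := not_and_or.1 (mt Prod.ext_iff.2 hpq)
    · rw [ha.inner_of_ne z h_fst, zero_mul]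
    · rw [hb.inner_of_ne z h_snd, mul_zero]

theorem inner_map_eq_zero_of_mem_cyclicSum_lpTadd (hsplit : CommutantSplits S T)
    (hfix : (S.prod T).FixesOnlyConstants e) (ha : ∀ i, a i ∈ L2Zero μ)
    (hb : ∀ i, b i ∈ L2Zero ν)
    {J : Lp ℂ 2 (μ.prod ν) →L[ℂ] Lp ℂ 2 (μ.prod ν)} (hJ : ∀ z, Commute J ((S.prod T).koopman z))
    {x y : Lp ℂ 2 (μ.prod ν)}
    (hx : x ∈ cyclicSum (S.prod T).koopman (fun i => lpTadd (a i) (b i)))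
    (hy : y ∈ cyclicSum (S.prod T).koopman (fun p : ι × ι => lpTmul (a p.1) (b p.2))) :
    inner ℂ (J x) y = 0 := by
  refine inner_map_eq_zero_of_mem_cyclicSum (fun i p z z' => ?_) hx hy
  rw [koopman_prod_lpTadd, koopman_prod_lpTmul, ← inner_conj_symm,
    hsplit.inner_lpTmul_map_lpTadd hfix hJ (koopman_mem_L2Zero S z' (ha _))
      (koopman_mem_L2Zero T z' (hb _)), _root_.map_zero]

end Generators

theorem hasSpectralMultiplicities_prod (hsplit : CommutantSplits S T)
    (hfix : (S.prod T).FixesOnlyConstants e) {n : ℕ} (hn : 2 ≤ n)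
    (hS : HasHomogeneousSpectrum S.koopman (L2Zero μ) n)
    (hT : HasHomogeneousSpectrum T.koopman (L2Zero ν) n) (hμ : L2Zero μ ≠ ⊥) (hν : L2Zero ν ≠ ⊥) :
    (S.prod T).HasSpectralMultiplicities {(n : ℕ∞), ((n * n : ℕ) : ℕ∞)} := by
  obtain ⟨φ, a, corr_a, ha⟩ := S.isUnitaryRep_koopman.exists_hasDiagonalCorrelation hS
  obtain ⟨ψ, b, corr_b, hb⟩ := T.isUnitaryRep_koopman.exists_hasDiagonalCorrelation hT
  have a_mem (i) : a i ∈ L2Zero μ := ha ▸ S.isUnitaryRep_koopman.mem_cyclicSum i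
  have b_mem (i) : b i ∈ L2Zero ν := hb ▸ T.isUnitaryRep_koopman.mem_cyclicSum i
  have unitary := (S.prod T).isUnitaryRep_koopman
  obtain ⟨f, hf, hf₀⟩ := Submodule.exists_mem_ne_zero_of_ne_bot hμ
  obtain ⟨g, hg, hg₀⟩ := Submodule.exists_mem_ne_zero_of_ne_bot hν
  have : NeZero n := ⟨by lia⟩
  let P := cyclicSum (S.prod T).koopman fun i => lpTadd (a i) (b i)
  let Q := cyclicSum (S.prod T).koopman fun p : Fin n × Fin n => lpTmul (a p.1) (b p.2)
  have : CompleteSpace P := isClosed_cyclicSum.completeSpace_coe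
  have : CompleteSpace Q := isClosed_cyclicSum.completeSpace_coe
  have orthogonal (J) (hJ : ∀ z, Commute J ((S.prod T).koopman z)) (x) (hx : x ∈ P) (y)
      (hy : y ∈ Q) : inner ℂ (J x) y = 0 :=
    inner_map_eq_zero_of_mem_cyclicSum_lpTadd hsplit hfix a_mem b_mem hJ hx hy
  have spectrum_P : HasHomogeneousSpectrum (S.prod T).koopman P n := by
    simpa only [Fintype.card_fin] using unitary.hasHomogeneousSpectrum_cyclicSum
      (hasDiagonalCorrelation_lpTadd corr_a corr_b a_mem)
  have spectrum_Q : HasHomogeneousSpectrum (S.prod T).koopman Q (n * n : ℕ) := by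
    simpa only [Fintype.card_prod, Fintype.card_fin] using
      unitary.hasHomogeneousSpectrum_cyclicSum (hasDiagonalCorrelation_lpTmul corr_a corr_b)
  refine hasMultiplicitySet_pair (P := P) (Q := Q) ?_ ?_ ?_ spectrum_P spectrum_Q
    (Submodule.isOrtho_iff_inner_eq.2 fun x hx y hy =>
      orthogonal 1 (fun _ => Commute.one_left _) x hx y hy)
    (unitary.restrictionsDisjoint (fun z _ => unitary.map_mem_cyclicSum z) orthogonal)
    (unitary.restrictionsDisjoint_symm (fun z _ => unitary.map_mem_cyclicSum z) orthogonal)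
    (cyclicSum_lpTadd_sup_cyclicSum_lpTmul hsplit hfix ha hb)
  · exact Nat.cast_injective.ne (by nlinarith)
  · exact (Submodule.ne_bot_iff _).2 ⟨_, lpTmul_lpOne_mem_cyclicSum_lpTadd hsplit hfix ha hb hf,
      lpTmul_ne_zero hf₀ lpOne_ne_zero⟩
  · exact (Submodule.ne_bot_iff _).2 ⟨_, lpTmul_mem_cyclicSum_lpTmul hsplit (ha ▸ hf) (hb ▸ hg),
      lpTmul_ne_zero hf₀ hg₀⟩

end Z2Action

end Product

/-! ### Splitting of the commutant -/

section Splitting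

variable {X Y : Type*} [MeasurableSpace X] [MeasurableSpace Y] {μ : Measure X} {ν : Measure Y}
  [IsProbabilityMeasure μ] [IsProbabilityMeasure ν]

variable (μ) in
/-- The operator `a I + (1 - a) Θ`, which scales `L²₀` by `a` and fixes the constants. -/
def shrink (a : ℝ) : Lp ℂ 2 μ →L[ℂ] Lp ℂ 2 μ :=
  (a : ℂ) • ContinuousLinearMap.id ℂ (Lp ℂ 2 μ) + (1 - a : ℂ) • constProj μ

theorem shrink_eq (a : ℝ) : shrink μ a = (a : ℂ) • 1 + (1 - a : ℂ) • constProj μ := rfl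

theorem shrink_one : shrink μ 1 = 1 := by
  rw [shrink_eq, Complex.ofReal_one, sub_self, zero_smul, add_zero, one_smul]

theorem shrink_mul (a b : ℝ) : shrink μ a * shrink μ b = shrink μ (a * b) := by
  have proj_mul_proj : constProj μ * constProj μ = constProj μ :=
    (Submodule.isIdempotentElem_starProjection (constSubspace μ)).eq
  simp only [shrink_eq, add_mul, mul_add, smul_mul_assoc, mul_smul_comm, one_mul, mul_one,
    proj_mul_proj, Complex.ofReal_mul]
  module

theorem star_shrink (a : ℝ) : star (shrink μ a) = shrink μ a := by
  have star_proj : star (constProj μ) = constProj μ :=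
    (isSelfAdjoint_starProjection (constSubspace μ)).star_eq
  simp only [shrink_eq, star_add, star_smul, star_one, star_proj, star_sub, RCLike.star_def,
    Complex.conj_ofReal]

theorem shrink_nonneg {a : ℝ} (ha : 0 ≤ a) : 0 ≤ shrink μ a := by
  rw [← Real.mul_self_sqrt ha, ← shrink_mul]
  conv_rhs => enter [1]; rw [← star_shrink]
  exact star_mul_self_nonneg _

theorem isUnit_shrink {a : ℝ} (ha : a ≠ 0) : IsUnit (shrink μ a) :=
  isUnit_iff_exists.2 ⟨shrink μ a⁻¹, by rw [shrink_mul, mul_inv_cancel₀ ha, shrink_one],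
    by rw [shrink_mul, inv_mul_cancel₀ ha, shrink_one]⟩

namespace Z2Action

theorem koopman_mul_shrink (S : Z2Action μ) (z : ℤ × ℤ) (b : ℝ) :
    S.koopman z * shrink μ b = (b : ℂ) • S.koopman z + (1 - b : ℂ) • constProj μ := by
  have koopman_mul_proj : S.koopman z * constProj μ = constProj μ := by
    ext1 f
    rw [mul_apply_eq_comp, constProj_apply, map_smul, koopman_lpOne]
  rw [shrink_eq, mul_add, mul_smul_comm, mul_smul_comm, mul_one, koopman_mul_proj]

/-- The weak limit is `V * N` with `V = 1 ⊗ (T̂^e ⊗ T̂^e)` unitary and `N` positive and invertible,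
so `V` is its polar part. -/
theorem commute_opTensor_of_weakOperatorTendsto {R : Z2Action μ} {T : Z2Action ν}
    {w : ℕ → ℤ × ℤ} {e : ℤ × ℤ} {a b : ℝ} (ha : 0 < a) (hb : 0 < b)
    (hR : WeakOperatorTendsto (fun i => R.koopman (w i)) (shrink μ a))
    (hT : WeakOperatorTendsto (fun i => T.koopman (w i)) (T.koopman e * shrink ν b))
    {J : Lp ℂ 2 ((μ.prod μ).prod (ν.prod ν)) →L[ℂ] Lp ℂ 2 ((μ.prod μ).prod (ν.prod ν))}
    (hJ : ∀ z, Commute J (((R.prod R).prod (T.prod T)).koopman z)) :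
    Commute J (opTensor 1 ((T.prod T).koopman e)) := by
  have unitary := ((R.prod R).prod (T.prod T)).isUnitaryRep_koopman
  set N := opTensor (opTensor (shrink μ a) (shrink μ a)) (opTensor (shrink ν b) (shrink ν b))
    with hN
  have tendsto_RR := hR.opTensor hR (fun i => R.norm_koopman_le _) fun i => R.norm_koopman_le _
  have tendsto_TT := hT.opTensor hT (fun i => T.norm_koopman_le _) fun i => T.norm_koopman_le _
  simp only [← koopman_prod] at tendsto_RR tendsto_TT
  have tendsto_prod : WeakOperatorTendsto (fun i => ((R.prod R).prod (T.prod T)).koopman (w i))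
      (opTensor 1 ((T.prod T).koopman e) * N) := by
    simpa only [hN, koopman_prod, opTensor_mul, one_mul] using
      tendsto_RR.opTensor tendsto_TT (fun i => norm_koopman_le _ _) fun i => norm_koopman_le _ _
  have N_nonneg : 0 ≤ N :=
    opTensor_nonneg (opTensor_nonneg (shrink_nonneg ha.le) (shrink_nonneg ha.le))
      (opTensor_nonneg (shrink_nonneg hb.le) (shrink_nonneg hb.le))
  have N_isUnit : IsUnit N :=
    isUnit_opTensor (isUnit_opTensor (isUnit_shrink ha.ne') (isUnit_shrink ha.ne'))
      (isUnit_opTensor (isUnit_shrink hb.ne') (isUnit_shrink hb.ne'))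
  have unitary_V : star (opTensor 1 ((T.prod T).koopman e)) * opTensor 1 ((T.prod T).koopman e) =
      (1 : Lp ℂ 2 ((μ.prod μ).prod (ν.prod ν)) →L[ℂ] Lp ℂ 2 ((μ.prod μ).prod (ν.prod ν))) := by
    rw [star_opTensor, opTensor_mul, (T.prod T).isUnitaryRep_koopman.star_mul_self, star_one,
      one_mul, opTensor_one]
  have commute_star := tendsto_prod.commute fun i => unitary.commute_star hJ (w i)
  exact commute_of_commute_mul_nonneg N_nonneg N_isUnit unitary_V
    (tendsto_prod.commute fun i => hJ (w i))
    (by simpa only [star_star] using commute_star.star_star)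

theorem isUnitaryRep_opTensor_one_koopman (T : Z2Action ν) :
    IsUnitaryRep fun z => opTensor (1 : Lp ℂ 2 μ →L[ℂ] Lp ℂ 2 μ) (T.koopman z) where
  map_zero := by rw [T.isUnitaryRep_koopman.map_zero, opTensor_one]
  map_add z z' := by rw [opTensor_mul, one_mul, T.isUnitaryRep_koopman.map_add]
  inner_map_map z := inner_opTensor_opTensor (by rw [star_one, one_mul])
    (T.isUnitaryRep_koopman.star_mul_self z)

end Z2Action

theorem L2Zero_ne_bot [MeasurableSpace.CountablySeparated X] [NullSingletonClass μ] :
    L2Zero μ ≠ ⊥ := by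
  intro L2Zero_eq_bot
  have : Nonempty X := μ.nonempty_of_neZero
  have ae_zero_or_one (U : Set X) (hU : MeasurableSet U) : U ∈ ae μ ∨ Uᶜ ∈ ae μ := by
    have indicator_mem : indicatorConstLp 2 hU (measure_ne_top μ U) (1 : ℂ) ∈ constSubspace μ :=
      mem_constSubspace_iff.2 fun k hk => by
        rw [L2Zero_eq_bot, Submodule.mem_bot] at hk
        rw [hk, inner_zero_left]
    obtain ⟨c, hc⟩ := Submodule.mem_span_singleton.1 indicator_mem
    have indicator_ae_eq : U.indicator (fun _ => (1 : ℂ)) =ᵐ[μ] fun _ => c := by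
      refine (indicatorConstLp_coeFn (p := 2) (hs := hU)
        (hμs := measure_ne_top μ U)).symm.trans ?_
      rw [← hc]
      filter_upwards [Lp.coeFn_smul c (lpOne μ), Lp.coeFn_const 2 μ (1 : ℂ)] with x h_smul h_const
      rw [h_smul, Pi.smul_apply, h_const, Function.const_apply, smul_eq_mul, mul_one]
    by_cases hc_one : c = 1
    · left
      filter_upwards [indicator_ae_eq] with x hx
      exact Set.mem_of_indicator_ne_zero (by rw [hx, hc_one]; exact one_ne_zero)
    · right
      filter_upwards [indicator_ae_eq] with x hx hxU
      exact hc_one (hx.symm.trans (Set.indicator_of_mem hxU _))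
  obtain ⟨x, hx⟩ := exists_singleton_mem_of_forall_separating MeasurableSet ae_zero_or_one
  obtain ⟨y, hy, hy'⟩ :=
    (Filter.Eventually.and hx (compl_mem_ae_iff.2 (measure_singleton x))).exists
  exact hy' hy

theorem L2Zero_prod_ne_bot (hμ : L2Zero μ ≠ ⊥) : L2Zero (μ.prod ν) ≠ ⊥ := by
  obtain ⟨f, hf, hf₀⟩ := Submodule.exists_mem_ne_zero_of_ne_bot hμ
  exact (Submodule.ne_bot_iff _).2
    ⟨lpTmul f (lpOne ν), lpTmul_mem_L2Zero_left hf _, lpTmul_ne_zero hf₀ lpOne_ne_zero⟩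

end Splitting

end

theorem mainTheorem2_general {X Y : Type*} [MeasurableSpace X] [MeasurableSpace Y]
    (μ : Measure X) [IsProbabilityMeasure μ] (hμ : L2Zero μ ≠ ⊥)
    (ν : Measure Y) [IsProbabilityMeasure ν] (hν : L2Zero ν ≠ ⊥)
    (R : Z2Action μ) (T : Z2Action ν) {e : ℤ × ℤ}
    (hErg : Ergodic (((R.prod R).prod (T.prod T)).map e) ((μ.prod μ).prod (ν.prod ν)))
    (hR : R.SymmSquareHasSimpleSpectrum) (hT : T.SymmSquareHasSimpleSpectrum)
    (w u : ℕ → ℤ × ℤ) (a₁ a₂ b₁ b₂ : ℝ)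
    (ha₁ : 0 < a₁) (ha₂ : 0 < a₂) (hb₁ : 0 < b₁) (hb₂ : 0 < b₂)
    (hRw : WeakOperatorTendsto (fun i => R.koopman (w i))
      ((a₁ : ℂ) • ContinuousLinearMap.id ℂ (Lp ℂ 2 μ) + (1 - a₁ : ℂ) • constProj μ))
    (hTw : WeakOperatorTendsto (fun i => T.koopman (w i))
      ((b₁ : ℂ) • T.koopman (1, 0) + (1 - b₁ : ℂ) • constProj ν))
    (hRu : WeakOperatorTendsto (fun i => R.koopman (u i))
      ((a₂ : ℂ) • ContinuousLinearMap.id ℂ (Lp ℂ 2 μ) + (1 - a₂ : ℂ) • constProj μ))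
    (hTu : WeakOperatorTendsto (fun i => T.koopman (u i))
      ((b₂ : ℂ) • T.koopman (0, 1) + (1 - b₂ : ℂ) • constProj ν)) :
    ((R.prod R).prod (T.prod T)).HasSpectralMultiplicities {2, 4} := by
  have hfix := Z2Action.fixesOnlyConstants_of_ergodic hErg
  rw [← Z2Action.koopman_mul_shrink] at hTw hTu
  have hsplit : Z2Action.CommutantSplits (R.prod R) (T.prod T) := fun J hJ =>
    (T.prod T).isUnitaryRep_opTensor_one_koopman.commute_of_commute_basis
      (Z2Action.commute_opTensor_of_weakOperatorTendsto ha₁ hb₁ hRw hTw hJ)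
      (Z2Action.commute_opTensor_of_weakOperatorTendsto ha₂ hb₂ hRu hTu hJ)
  exact Z2Action.hasSpectralMultiplicities_prod hsplit hfix le_rfl
    (hR.hasHomogeneousSpectrum_prod hfix.fst) (hT.hasHomogeneousSpectrum_prod hfix.snd)
    (L2Zero_prod_ne_bot hμ) (L2Zero_prod_ne_bot hν)

theorem mainTheorem2 {X Y : Type*}
    [MeasurableSpace X] [StandardBorelSpace X] [MeasurableSpace Y] [StandardBorelSpace Y]
    (μ : Measure X) [IsProbabilityMeasure μ] [NullSingletonClass μ]
    (ν : Measure Y) [IsProbabilityMeasure ν] [NullSingletonClass ν]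
    (R : Z2Action μ) (T : Z2Action ν)
    (hErg : ((R.prod R).prod (T.prod T)).TotallyErgodic)
    (hR : R.SymmSquareHasSimpleSpectrum) (hT : T.SymmSquareHasSimpleSpectrum)
    (w u : ℕ → ℤ × ℤ) (a₁ a₂ b₁ b₂ : ℝ)
    (ha₁ : 0 < a₁) (ha₂ : 0 < a₂) (hb₁ : 0 < b₁) (hb₂ : 0 < b₂)
    (hRw : WeakOperatorTendsto (fun i => R.koopman (w i))
      ((a₁ : ℂ) • ContinuousLinearMap.id ℂ (Lp ℂ 2 μ) + (1 - a₁ : ℂ) • constProj μ))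
    (hTw : WeakOperatorTendsto (fun i => T.koopman (w i))
      ((b₁ : ℂ) • T.koopman (1, 0) + (1 - b₁ : ℂ) • constProj ν))
    (hRu : WeakOperatorTendsto (fun i => R.koopman (u i))
      ((a₂ : ℂ) • ContinuousLinearMap.id ℂ (Lp ℂ 2 μ) + (1 - a₂ : ℂ) • constProj μ))
    (hTu : WeakOperatorTendsto (fun i => T.koopman (u i))
      ((b₂ : ℂ) • T.koopman (0, 1) + (1 - b₂ : ℂ) • constProj ν)) :
    ((R.prod R).prod (T.prod T)).HasSpectralMultiplicities {2, 4} :=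
  mainTheorem2_general μ L2Zero_ne_bot ν L2Zero_ne_bot R T (hErg (1, 0) (by simp)) hR hT w u
    a₁ a₂ b₁ b₂ ha₁ ha₂ hb₁ hb₂ hRw hTw hRu hTu
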